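/- Let $k$ be a field and let $A$ be a connected differential graded (DG) $k$-algebra, that is, a cochain DG algebra $A=\bigoplus_{i\ge 0}A^i$ with differential of degree $+1$ and $A^0=k$. Regard $k=A/A^{\ge 1}$ as a left DG $A$-module concentrated in degree $0$. A semi-free filtration of a left DG $A$-module $F$ is an increasing sequence of DG submodules $0=F(-1)\subseteq F(0)\subseteq F(1)\subseteq\cdots$ with union $F$ such that every $F(n)/F(n-1)$ is DG free, i.e. has an $A$-basis of homogeneous cocycles; $F$ is semi-free if it has such a filtration. The filtration is strictly increasing if $F(n-1)\ne F(n)$ whenever $F(n-1)\neq F$, and it has length $n$ if $n\ge 0$ is the least index with $F(n)=F$ (so the zero module has length $0$). The DG free class of $F$ is the least $n$ such that $F$ has a strictly increasing semi-free filtration of length $n$, or $+\infty$ if there is none. The cone length $\mathrm{cl}_A M$ of a left DG $A$-module $M$ is the infimum of the DG free classes of all semi-free $F$ admitting a quasi-isomorphism $F\to M$, and $l.\mathrm{Gl.dim}\,A=\sup_M \mathrm{cl}_A M$, where $M$ runs over all left DG $A$-modules. Let $\mathrm{gl.dim}\,H(A)$ denote the global dimension of the graded cohomology algebra $H(A)$,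 i.e. the supremum of the projective dimensions of all $\mathbb Z$-graded left $H(A)$-modules. Then $$\mathrm{cl}_A k=1\iff l.\mathrm{Gl.dim}\,A=1\iff \mathrm{gl.dim}\,H(A)=1 .$$ -/

import Mathlib

universe u

open DirectSum (decompose decompose_add decompose_of_mem_same decompose_of_mem_ne)

/-! ### Graded modules over a graded algebra, graded global dimension -/

/-- A left `ℤ`-graded module over a `k`-algebra `R` graded by `𝓡`. -/
structure GrModule {k R : Type u} [Field k] [Ring R] [Algebra k R] (𝓡 : ℤ → Submodule k R) where
  carrier : Type u
  [addCommGroup : AddCommGroup carrier]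
  [moduleBase : Module k carrier]
  [module : Module R carrier]
  [isScalarTower : IsScalarTower k R carrier]
  /-- the homogeneous component of degree `i` -/
  gr : ℤ → Submodule k carrier
  [decomposition : DirectSum.Decomposition gr]
  smul_mem : ∀ (i j : ℤ) (r : R) (m : carrier), r ∈ 𝓡 i → m ∈ gr j → r • m ∈ gr (i + j)

namespace GrModule

variable {k R : Type u} [Field k] [Ring R] [Algebra k R] {𝓡 : ℤ → Submodule k R}

instance : CoeSort (GrModule 𝓡) (Type u) := ⟨GrModule.carrier⟩

attribute [instance] GrModule.addCommGroup GrModule.moduleBase GrModule.module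
  GrModule.isScalarTower GrModule.decomposition

/-- A morphism of graded modules: an `R`-linear map of degree zero. -/
structure Hom (M N : GrModule 𝓡) where
  toLinearMap : M →ₗ[R] N
  map_mem : ∀ (i : ℤ) (m : M), m ∈ M.gr i → toLinearMap m ∈ N.gr i

/-- `P` is a projective object of the category of graded modules. -/
def IsProjective (P : GrModule 𝓡) : Prop :=
  ∀ (M N : GrModule 𝓡) (g : Hom M N) (f : Hom P N), Function.Surjective g.toLinearMap →
    ∃ h : Hom P M, ∀ x, g.toLinearMap (h.toLinearMap x) = f.toLinearMap x

/-- `M` has a resolution `0 → P_n → ⋯ → P_0 → M → 0` by projective graded modules; the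
resolution is given by the short exact sequences `0 → K → P → M → 0` it is spliced from. -/
def HasProjDimLE : ℕ → GrModule 𝓡 → Prop
  | 0, M => M.IsProjective
  | n + 1, M => ∃ (K P : GrModule 𝓡) (i : Hom K P) (p : Hom P M),
      Function.Injective i.toLinearMap ∧ Function.Surjective p.toLinearMap ∧
      LinearMap.range i.toLinearMap = LinearMap.ker p.toLinearMap ∧
      P.IsProjective ∧ HasProjDimLE n K

/-- The projective dimension of a graded module (`⊤` if there is no finite resolution). -/
noncomputable def projDim (M : GrModule 𝓡) : ℕ∞ :=
  ⨅ (n : ℕ) (_ : M.HasProjDimLE n), (n : ℕ∞)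

end GrModule

/-- The (left) global dimension of a graded algebra: the supremum of the projective dimensions
of all its graded left modules. -/
noncomputable def gradedGlobalDim {k R : Type u} [Field k] [Ring R] [Algebra k R]
    (𝓡 : ℤ → Submodule k R) [GradedAlgebra 𝓡] : ℕ∞ :=
  ⨆ M : GrModule 𝓡, M.projDim

/-! ### Differential graded algebras -/

/-- A (cochain) differential graded algebra over the field `k`. -/
structure DGAlgebra (k : Type u) [Field k] where
  carrier : Type u
  [ring : Ring carrier]
  [algebra : Algebra k carrier]
  /-- the homogeneous component of degree `i` -/
  gr : ℤ → Submodule k carrier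
  [gradedAlgebra : GradedAlgebra gr]
  d : carrier →ₗ[k] carrier
  d_mem : ∀ (i : ℤ) (a : carrier), a ∈ gr i → d a ∈ gr (i + 1)
  d_d : ∀ a : carrier, d (d a) = 0
  leibniz : ∀ (i : ℤ) (a b : carrier), a ∈ gr i → d (a * b) = d a * b + i.negOnePow • (a * d b)

namespace DGAlgebra

variable {k : Type u} [Field k]

instance : CoeSort (DGAlgebra k) (Type u) := ⟨DGAlgebra.carrier⟩

attribute [instance] DGAlgebra.ring DGAlgebra.algebra DGAlgebra.gradedAlgebra

/-- `A` is connected: `A^i = 0` for `i < 0` and `A^0 = k`. -/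
structure IsConnected (A : DGAlgebra k) : Prop where
  gr_neg : ∀ i : ℤ, i < 0 → A.gr i = ⊥
  gr_zero : ∀ a ∈ A.gr 0, ∃! c : k, algebraMap k A c = a

variable (A : DGAlgebra k)

theorem proj_d (x : A) (i : ℤ) :
    GradedAlgebra.proj A.gr (i + 1) (A.d x) = A.d (GradedAlgebra.proj A.gr i x) := by
  induction x using DirectSum.Decomposition.inductionOn A.gr with
  | zero => simp
  | @homogeneous j m =>
    simp only [GradedAlgebra.proj_apply]
    by_cases h : j = i
    · subst h
      rw [decompose_of_mem_same _ (A.d_mem _ _ m.2), decompose_of_mem_same _ m.2]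
    · rw [decompose_of_mem_ne _ (A.d_mem _ _ m.2) (by omega), decompose_of_mem_ne _ m.2 h,
        map_zero]
  | add a b ha hb => simp only [map_add, ha, hb]

theorem d_one : A.d 1 = 0 := by
  have h := A.leibniz 0 1 1 SetLike.GradedOne.one_mem
  simpa using h

theorem d_mul_of_cocycle_right (x z : A) (hz : A.d z = 0) : A.d (x * z) = A.d x * z := by
  induction x using DirectSum.Decomposition.inductionOn A.gr with
  | zero => simp
  | @homogeneous j m => simp [A.leibniz j _ z m.2, hz]
  | add a b ha hb => simp only [map_add, add_mul, ha, hb]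

theorem mul_d_mem_range (z x : A) (hz : A.d z = 0) : ∃ y, A.d y = z * A.d x := by
  classical
  have key : ∀ i, ∃ y, A.d y = GradedAlgebra.proj A.gr i z * A.d x := by
    intro i
    have h0 : A.d (GradedAlgebra.proj A.gr i z) = 0 := by rw [← proj_d, hz, map_zero]
    refine ⟨i.negOnePow • (GradedAlgebra.proj A.gr i z * x), ?_⟩
    have h := A.leibniz i (GradedAlgebra.proj A.gr i z) x (by simp)
    rw [h0, zero_mul, zero_add] at h
    rw [Units.smul_def, map_zsmul, h, Units.smul_def, smul_smul, ← Units.val_mul]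
    simp
  choose y hy using key
  refine ⟨∑ i ∈ (decompose A.gr z).support, y i, ?_⟩
  rw [map_sum, Finset.sum_congr rfl fun i _ => hy i, ← Finset.sum_mul]
  congr 1
  exact DirectSum.sum_support_decompose A.gr z

/-- The subalgebra of cocycles. -/
def cocycles : Subalgebra k A where
  carrier := {a | A.d a = 0}
  mul_mem' {a b} ha hb := by
    simp only [Set.mem_ofPred_eq] at *
    rw [A.d_mul_of_cocycle_right a b hb, ha, zero_mul]
  add_mem' {a b} ha hb := by
    simp only [Set.mem_ofPred_eq] at *
    rw [map_add, ha, hb, add_zero]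
  algebraMap_mem' c := by
    simp only [Set.mem_ofPred_eq]
    rw [Algebra.algebraMap_eq_smul_one, map_smul, A.d_one, smul_zero]

/-- The ideal of coboundaries in the algebra of cocycles. -/
def coboundaries : Ideal A.cocycles where
  carrier := {z | ∃ x, A.d x = z}
  zero_mem' := ⟨0, by simp⟩
  add_mem' := by
    rintro a b ⟨x, hx⟩ ⟨y, hy⟩
    exact ⟨x + y, by simp [hx, hy]⟩
  smul_mem' := by
    rintro c z ⟨x, hx⟩
    obtain ⟨y, hy⟩ := A.mul_d_mem_range c x c.2
    exact ⟨y, by simp [hy, hx]⟩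

instance : A.coboundaries.IsTwoSided where
  mul_mem_of_left {z} c := by
    rintro ⟨x, hx⟩
    exact ⟨x * c, by simp [A.d_mul_of_cocycle_right x c c.2, hx]⟩

/-- The cohomology algebra `H(A)`. -/
abbrev Cohomology : Type u := A.cocycles ⧸ A.coboundaries

/-- The homogeneous component `H^i(A)`: classes of cocycles of degree `i`. -/
def cohomologyGr (i : ℤ) : Submodule k A.Cohomology :=
  ((A.gr i).comap A.cocycles.val.toLinearMap).map
    (Ideal.Quotient.mkₐ k A.coboundaries).toLinearMap

/-- The projection of a cocycle on its component of degree `i`. -/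
noncomputable def cocyclesProj (i : ℤ) : A.cocycles →ₗ[k] A.cocycles :=
  LinearMap.codRestrict (Subalgebra.toSubmodule A.cocycles)
    (GradedAlgebra.proj A.gr i ∘ₗ A.cocycles.val.toLinearMap) fun z => by
      change A.d (GradedAlgebra.proj A.gr i z) = 0
      rw [← proj_d, show A.d (z : A) = 0 from z.2, map_zero]

theorem coe_cocyclesProj (i : ℤ) (z : A.cocycles) :
    (A.cocyclesProj i z : A) = decompose A.gr (z : A) i := rfl

/-- The projection of `H(A)` on `H^i(A)`, as an endomorphism of `H(A)`. -/
noncomputable def cohomologyProj (i : ℤ) : A.Cohomology →ₗ[k] A.Cohomology :=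
  Submodule.mapQ (A.coboundaries.restrictScalars k) (A.coboundaries.restrictScalars k)
    (A.cocyclesProj i) (by
      rintro z ⟨x, hx⟩
      refine ⟨GradedAlgebra.proj A.gr (i - 1) x, ?_⟩
      rw [← proj_d, hx, sub_add_cancel]
      rfl)

theorem cohomologyProj_mk (i : ℤ) (z : A.cocycles) :
    A.cohomologyProj i (Ideal.Quotient.mk A.coboundaries z) =
      Ideal.Quotient.mk A.coboundaries (A.cocyclesProj i z) := rfl

theorem cohomologyProj_mem (i : ℤ) (x : A.Cohomology) :
    A.cohomologyProj i x ∈ A.cohomologyGr i := by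
  obtain ⟨z, rfl⟩ := Ideal.Quotient.mk_surjective x
  exact ⟨A.cocyclesProj i z, by simp [coe_cocyclesProj], rfl⟩

theorem cohomologyProj_of_mem_same (i : ℤ) (x : A.Cohomology) (hx : x ∈ A.cohomologyGr i) :
    A.cohomologyProj i x = x := by
  obtain ⟨z, hz, rfl⟩ := hx
  change Ideal.Quotient.mk A.coboundaries _ = Ideal.Quotient.mk A.coboundaries _
  congr 1
  exact Subtype.ext (decompose_of_mem_same A.gr hz)

theorem cohomologyProj_of_mem_ne (i j : ℤ) (hij : i ≠ j) (x : A.Cohomology)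
    (hx : x ∈ A.cohomologyGr i) : A.cohomologyProj j x = 0 := by
  obtain ⟨z, hz, rfl⟩ := hx
  change Ideal.Quotient.mk A.coboundaries _ = 0
  rw [show A.cocyclesProj j z = 0 from Subtype.ext (decompose_of_mem_ne A.gr hz hij), map_zero]

theorem cohomology_isInternal : DirectSum.IsInternal A.cohomologyGr := by
  classical
  apply DirectSum.isInternal_submodule_of_iSupIndep_of_iSup_eq_top
  · rw [iSupIndep_def]
    intro i
    rw [Submodule.disjoint_def]
    intro x hx hx'
    rw [← A.cohomologyProj_of_mem_same i x hx]
    have hle : (⨆ j, ⨆ (_ : j ≠ i), A.cohomologyGr j) ≤ LinearMap.ker (A.cohomologyProj i) :=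
      iSup₂_le fun j hj y hy => A.cohomologyProj_of_mem_ne j i hj y hy
    exact hle hx'
  · rw [eq_top_iff]
    rintro x -
    obtain ⟨z, rfl⟩ := Ideal.Quotient.mk_surjective x
    have hz : z = ∑ i ∈ (decompose A.gr (z : A)).support, A.cocyclesProj i z := by
      apply Subtype.ext
      rw [AddSubmonoidClass.coe_finsetSum]
      exact (DirectSum.sum_support_decompose A.gr (z : A)).symm
    rw [hz, map_sum]
    refine Submodule.sum_mem _ fun i _ => ?_
    exact Submodule.mem_iSup_of_mem i (A.cohomologyProj_mem i (Ideal.Quotient.mk _ z))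

instance cohomology_gradedMonoid : SetLike.GradedMonoid A.cohomologyGr where
  one_mem := ⟨1, (SetLike.GradedOne.one_mem : (1 : A) ∈ A.gr 0), rfl⟩
  mul_mem := by
    rintro i j _ _ ⟨x, hx, rfl⟩ ⟨y, hy, rfl⟩
    exact ⟨x * y, (SetLike.GradedMul.mul_mem hx hy : (x * y : A) ∈ A.gr (i + j)),
      map_mul (Ideal.Quotient.mk A.coboundaries) x y⟩

/-- `H(A)` is a graded algebra. -/
noncomputable instance cohomology_gradedAlgebra : GradedAlgebra A.cohomologyGr where
  __ := A.cohomology_gradedMonoid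
  __ := A.cohomology_isInternal.chooseDecomposition

end DGAlgebra

/-! ### Differential graded modules -/

/-- A left DG module over the DG algebra `A`. -/
structure DGModule {k : Type u} [Field k] (A : DGAlgebra k) where
  carrier : Type u
  [addCommGroup : AddCommGroup carrier]
  [moduleBase : Module k carrier]
  [module : Module A carrier]
  [isScalarTower : IsScalarTower k A carrier]
  /-- the homogeneous component of degree `i` -/
  gr : ℤ → Submodule k carrier
  [decomposition : DirectSum.Decomposition gr]
  smul_mem : ∀ (i j : ℤ) (a : A) (m : carrier), a ∈ A.gr i → m ∈ gr j → a • m ∈ gr (i + j)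
  d : carrier →ₗ[k] carrier
  d_mem : ∀ (i : ℤ) (m : carrier), m ∈ gr i → d m ∈ gr (i + 1)
  d_d : ∀ m : carrier, d (d m) = 0
  leibniz : ∀ (i : ℤ) (a : A) (m : carrier), a ∈ A.gr i →
    d (a • m) = A.d a • m + i.negOnePow • (a • d m)

namespace DGModule

variable {k : Type u} [Field k] {A : DGAlgebra k}

instance : CoeSort (DGModule A) (Type u) := ⟨DGModule.carrier⟩

attribute [instance] DGModule.addCommGroup DGModule.moduleBase DGModule.module
  DGModule.isScalarTower DGModule.decomposition

/-- A morphism of DG modules: an `A`-linear map of degree zero commuting with differentials. -/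
structure Hom (M N : DGModule A) where
  toLinearMap : M →ₗ[A] N
  map_mem : ∀ (i : ℤ) (m : M), m ∈ M.gr i → toLinearMap m ∈ N.gr i
  comm : ∀ m : M, N.d (toLinearMap m) = toLinearMap (M.d m)

/-- The cohomology `H(M) = ker d / im d` (the sum of all `H^i(M)`). -/
abbrev Cohomology (M : DGModule A) : Type u :=
  LinearMap.ker M.d ⧸ (LinearMap.range M.d).comap (LinearMap.ker M.d).subtype

/-- The map `H(f) : H(M) → H(N)` induced by a morphism `f`. -/
def Hom.cohomologyMap {M N : DGModule A} (f : Hom M N) : M.Cohomology →ₗ[k] N.Cohomology :=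
  Submodule.mapQ _ _
    ((f.toLinearMap.restrictScalars k).restrict (p := LinearMap.ker M.d) (q := LinearMap.ker N.d)
      fun m hm => by
        change N.d (f.toLinearMap m) = 0
        rw [f.comm, show M.d m = 0 from hm, map_zero])
    (by
      rintro z ⟨x, hx⟩
      exact ⟨f.toLinearMap x, by rw [f.comm, hx]; rfl⟩)

/-- `f` is a quasi-isomorphism: `H(f)` is an isomorphism. -/
def Hom.IsQuasiIso {M N : DGModule A} (f : Hom M N) : Prop :=
  Function.Bijective f.cohomologyMap

/-- An `A`-submodule is a DG submodule if it is graded and stable under the differential. -/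
structure IsDGSubmodule (M : DGModule A) (N : Submodule A M) : Prop where
  homogeneous : ∀ (i : ℤ), ∀ x ∈ N, (decompose M.gr x i : M) ∈ N
  d_mem : ∀ x ∈ N, M.d x ∈ N

/-- For DG submodules `N' ≤ N` of `M`, the quotient `N / N'` is DG free: it has an `A`-basis
consisting of homogeneous cocycles. The basis is given by homogeneous representatives `e y ∈ N`
with `d (e y) ∈ N'`. -/
def IsDGFreeQuotient (M : DGModule A) (N' N : Submodule A M) : Prop :=
  ∃ (Y : Type u) (e : Y → M),
    (∀ y, e y ∈ N ∧ (∃ i : ℤ, e y ∈ M.gr i) ∧ M.d (e y) ∈ N') ∧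
    LinearIndependent A (fun y => N'.mkQ (e y)) ∧
    Submodule.span A (Set.range fun y => N'.mkQ (e y)) = N.map N'.mkQ

/-- A semi-free filtration `0 = F(-1) ≤ F(0) ≤ F(1) ≤ ⋯` of `F`. -/
structure SemiFreeFiltration (F : DGModule A) where
  fil : ℕ → Submodule A F
  isDGSubmodule : ∀ n, F.IsDGSubmodule (fil n)
  mono : Monotone fil
  exhaustive : ⨆ n, fil n = ⊤
  zero_free : F.IsDGFreeQuotient ⊥ (fil 0)
  succ_free : ∀ n, F.IsDGFreeQuotient (fil n) (fil (n + 1))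

/-- The step `F(n - 1)` of a semi-free filtration, where `F(-1) = 0`. -/
def SemiFreeFiltration.prev {F : DGModule A} (Φ : F.SemiFreeFiltration) : ℕ → Submodule A F
  | 0 => ⊥
  | n + 1 => Φ.fil n

/-- `F(n - 1) ≠ F(n)` as long as `F(n - 1) ≠ F`. -/
def SemiFreeFiltration.IsStrictlyIncreasing {F : DGModule A} (Φ : F.SemiFreeFiltration) : Prop :=
  ∀ n, Φ.prev n ≠ ⊤ → Φ.prev n ≠ Φ.fil n

/-- The filtration has length `n`: `n` is the least index with `F(n) = F`. (So the zero module
has length `0`; for `F ≠ 0` this says that `F(n) = F` and `F(n - 1) ≠ F`.) -/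
def SemiFreeFiltration.HasLength {F : DGModule A} (Φ : F.SemiFreeFiltration) (n : ℕ) : Prop :=
  Φ.fil n = ⊤ ∧ ∀ m < n, Φ.fil m ≠ ⊤

/-- A DG module is semi-free if it has a semi-free filtration. -/
def IsSemiFree (F : DGModule A) : Prop := Nonempty F.SemiFreeFiltration

/-- The DG free class: the least length of a strictly increasing semi-free filtration, `⊤` if
there is none of finite length. -/
noncomputable def dgFreeClass (F : DGModule A) : ℕ∞ :=
  ⨅ (n : ℕ) (_ : ∃ Φ : F.SemiFreeFiltration, Φ.IsStrictlyIncreasing ∧ Φ.HasLength n), (n : ℕ∞)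

/-- The cone length `cl_A M`: the infimum of the DG free classes of all semi-free resolutions
of `M`. -/
noncomputable def coneLength (M : DGModule A) : ℕ∞ :=
  ⨅ (F : DGModule A) (_ : F.IsSemiFree ∧ ∃ ε : Hom F M, ε.IsQuasiIso), F.dgFreeClass

end DGModule

namespace DGAlgebra

variable {k : Type u} [Field k]

/-- The left global dimension of `A`: the supremum of the cone lengths of all DG modules. -/
noncomputable def leftGlobalDim (A : DGAlgebra k) : ℕ∞ :=
  ⨆ M : DGModule A, M.coneLength

/-- The scalar `c` such that `a` has degree zero component `c • 1`. -/
noncomputable def IsConnected.scalar {A : DGAlgebra k} (hA : A.IsConnected) (a : A) : k :=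
  (hA.gr_zero (decompose A.gr a 0) (decompose A.gr a 0).2).choose

theorem IsConnected.algebraMap_scalar {A : DGAlgebra k} (hA : A.IsConnected) (a : A) :
    algebraMap k A (hA.scalar a) = decompose A.gr a 0 :=
  (hA.gr_zero (decompose A.gr a 0) (decompose A.gr a 0).2).choose_spec.1

theorem IsConnected.algebraMap_mem (A : DGAlgebra k) (c : k) : algebraMap k A c ∈ A.gr 0 := by
  rw [Algebra.algebraMap_eq_smul_one]
  exact Submodule.smul_mem _ _ SetLike.GradedOne.one_mem

theorem IsConnected.algebraMap_injective {A : DGAlgebra k} (hA : A.IsConnected) :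
    Function.Injective (algebraMap k A) := fun c _ h =>
  (hA.gr_zero (algebraMap k A c) (algebraMap_mem A c)).unique rfl h.symm

theorem IsConnected.decompose_mul_zero {A : DGAlgebra k} (hA : A.IsConnected) (a b : A) :
    (decompose A.gr (a * b) 0 : A) = decompose A.gr a 0 * decompose A.gr b 0 := by
  induction a using DirectSum.Decomposition.inductionOn A.gr with
  | zero => simp
  | add x y hx hy =>
    rw [add_mul, decompose_add, decompose_add, DirectSum.add_apply, DirectSum.add_apply,
      Submodule.coe_add, Submodule.coe_add, hx, hy, add_mul]
  | @homogeneous i x =>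
    induction b using DirectSum.Decomposition.inductionOn A.gr with
    | zero => simp
    | add x y hx hy =>
      rw [mul_add, decompose_add, decompose_add, DirectSum.add_apply, DirectSum.add_apply,
        Submodule.coe_add, Submodule.coe_add, hx, hy, mul_add]
    | @homogeneous j y =>
      have hz : ∀ (l : ℤ) (w : A.gr l), l < 0 → (w : A) = 0 := fun l w hl => by
        have h : ∀ v ∈ A.gr l, v = 0 := by
          rw [hA.gr_neg l hl]
          exact fun v hv => hv
        exact h w w.2
      have hxy : (x * y : A) ∈ A.gr (i + j) := SetLike.GradedMul.mul_mem x.2 y.2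
      rcases lt_trichotomy i 0 with hi | rfl | hi
      · simp [hz i x hi]
      · rcases eq_or_ne j 0 with rfl | hj
        · rw [decompose_of_mem_same _ x.2, decompose_of_mem_same _ y.2,
            decompose_of_mem_same _ (by simpa using hxy)]
        · rw [decompose_of_mem_ne _ y.2 hj, decompose_of_mem_ne _ hxy (by omega), mul_zero]
      · rcases lt_or_ge j 0 with hj | hj
        · simp [hz j y hj]
        · rw [decompose_of_mem_ne _ x.2 hi.ne', decompose_of_mem_ne _ hxy (by omega), zero_mul]

/-- The augmentation `A → A^0 = k` of a connected DG algebra. -/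
noncomputable def IsConnected.augmentation {A : DGAlgebra k} (hA : A.IsConnected) : A →ₐ[k] k where
  toFun := hA.scalar
  map_one' := hA.algebraMap_injective (by
    rw [hA.algebraMap_scalar, decompose_of_mem_same _ SetLike.GradedOne.one_mem, map_one])
  map_mul' a b := hA.algebraMap_injective (by
    rw [map_mul, hA.algebraMap_scalar, hA.algebraMap_scalar, hA.algebraMap_scalar,
      hA.decompose_mul_zero])
  map_zero' := hA.algebraMap_injective (by rw [hA.algebraMap_scalar]; simp)
  map_add' a b := hA.algebraMap_injective (by
    rw [map_add, hA.algebraMap_scalar, hA.algebraMap_scalar, hA.algebraMap_scalar]; simp)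
  commutes' c := hA.algebraMap_injective (by
    rw [hA.algebraMap_scalar, decompose_of_mem_same _ (algebraMap_mem A c)]; rfl)

theorem IsConnected.augmentation_of_mem {A : DGAlgebra k} (hA : A.IsConnected) (i : ℤ) (a : A)
    (ha : a ∈ A.gr i) (hi : i ≠ 0) : hA.augmentation a = 0 :=
  hA.algebraMap_injective (by
    rw [map_zero]
    exact (hA.algebraMap_scalar a).trans (decompose_of_mem_ne _ ha hi))

/-- The grading of the vector space `k` concentrated in degree zero. -/
def trivialGr (k : Type u) [Field k] (i : ℤ) : Submodule k k := if i = 0 then ⊤ else ⊥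

noncomputable instance trivialGr_decomposition : DirectSum.Decomposition (trivialGr k) where
  decompose' c := DirectSum.of (fun i => trivialGr k i) 0 ⟨c, by simp [trivialGr]⟩
  left_inv c := by simp
  right_inv x := by
    induction x using DirectSum.induction_on with
    | zero =>
      simp only [map_zero]
      exact (DirectSum.of _ 0).map_zero
    | of i x =>
      rcases eq_or_ne i 0 with rfl | hi
      · simp
      · have hx : x = 0 := by
          have h := x.2
          simp only [trivialGr, hi, if_false, Submodule.mem_bot] at h
          exact Subtype.ext h
        subst hx
        simp only [map_zero]
        exact (DirectSum.of _ 0).map_zero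
    | add x y hx hy =>
      conv_rhs => rw [← hx, ← hy, ← map_add]
      congr 1
      rw [← map_add]

/-- The trivial DG module `k` over a connected DG algebra: it is concentrated in degree zero,
`A` acts through the augmentation and the differential vanishes. -/
noncomputable def IsConnected.trivialModule {A : DGAlgebra k} (hA : A.IsConnected) :
    DGModule A :=
  letI : Module A k := Module.compHom k hA.augmentation.toRingHom
  have smul_eq : ∀ (a : A) (c : k), a • c = hA.augmentation a * c := fun _ _ => rfl
  { carrier := k
    isScalarTower := ⟨fun c a x => by simp [smul_eq, mul_assoc]⟩
    gr := trivialGr k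
    smul_mem := by
      intro i j a c ha hc
      rw [smul_eq]
      rcases eq_or_ne i 0 with rfl | hi
      · rw [zero_add]
        exact (trivialGr k j).smul_mem _ hc
      · rw [hA.augmentation_of_mem i a ha hi, zero_mul]
        exact zero_mem _
    d := 0
    d_mem := fun i m _ => zero_mem _
    d_d := fun _ => rfl
    leibniz := by
      intro i a m ha
      have h : hA.augmentation (A.d a) = 0 := by
        rcases eq_or_ne i (-1) with rfl | hi
        · rw [hA.gr_neg (-1) (by norm_num), Submodule.mem_bot] at ha
          rw [ha, map_zero, map_zero]
        · exact hA.augmentation_of_mem (i + 1) _ (A.d_mem i a ha) (by omega)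
      rw [smul_eq (A.d a), h]
      simp }

end DGAlgebra

/-! ### Homogeneous components -/

/-! Write `R` for `H(A)` and `I` for the kernel of its augmentation `π : R → k`. Lift a homogeneous
`k`-basis of `I / I²` to a family `v`, indexed by `T`, that generates the left ideal `I`. It is
minimal: in every relation `∑ h_t v_t = 0` all `h_t` lie in `I` (`exists_isMinimalGenerators`). Each
of the three invariants is at most 1 exactly when `v` is left linearly independent, that is, when
`I` is a free left module on `v`, and is at most 0 exactly when `T` is empty. So all three equal 1
under one and the same condition.

Upper bounds. If `v` is independent, a graded module `N` with homogeneous `k`-basis `B` has the free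
resolution `0 → R ⊗ kT ⊗ kB → R ⊗ kB → N → 0` whose first map sends `t ⊗ b` to `v_t ⊗ b - 1 ⊗ v_t b`
(`standardMap_injective`, `exists_standardMap_add`). For a DG module `M`, let `B` be a basis of
`H(M)` represented by cocycles and represent the `v_t` by cocycles `z_t` of `A`. The same formula is
the differential of a semi-free module with two filtration steps, and exactness over `H(A)` makes it
quasi-isomorphic to `M` (`DGModule.exists_standardResolution`). If `T` is empty, only the term on
`B` remains.

Lower bounds. These need only the trivial module `k`. A short resolution of `k` is compared with the
beginning of its minimal resolution, which has generators `1` and `T`. The comparison yields a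
matrix `b` over `R` with `∑ b_ts v_s = v_t`, so minimality makes `b` the identity modulo `I`. A
relation `h` among the `v_t` becomes a relation in the short resolution, which has no further term,
and this forces `h b = 0`. Induction on the degree then gives `h = 0`
(`eq_zero_of_sum_smul_eq_zero`). The argument runs once for projective resolutions
(`linearIndependent_of_projDim_le_one`) and once, at cochain level, for semi-free filtrations with
`F(1) = F` (`linearIndependent_of_fil_one_eq_top`). -/

section GradedProjection

variable {k M : Type*} [Field k] [AddCommGroup M] [Module k M]

/-- The projection of a graded vector space on its component of degree `i`. -/
def gradedProj (𝓜 : ℤ → Submodule k M) [DirectSum.Decomposition 𝓜] (i : ℤ) : M →ₗ[k] M :=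
  (𝓜 i).subtype ∘ₗ DirectSum.component k ℤ (fun i => 𝓜 i) i ∘ₗ
    (DirectSum.decomposeLinearEquiv 𝓜).toLinearMap

variable (𝓜 : ℤ → Submodule k M) [DirectSum.Decomposition 𝓜]

theorem gradedProj_mem (i : ℤ) (x : M) : gradedProj 𝓜 i x ∈ 𝓜 i := (decompose 𝓜 x i).2

theorem gradedProj_of_mem {i : ℤ} {x : M} (hx : x ∈ 𝓜 i) : gradedProj 𝓜 i x = x :=
  decompose_of_mem_same 𝓜 hx

theorem gradedProj_of_mem_ne {i j : ℤ} {x : M} (hx : x ∈ 𝓜 i) (hij : i ≠ j) :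
    gradedProj 𝓜 j x = 0 :=
  decompose_of_mem_ne 𝓜 hx hij

theorem eq_zero_of_gradedProj {x : M} (h : ∀ i, gradedProj 𝓜 i x = 0) : x = 0 := by
  apply (DirectSum.decompose 𝓜).injective
  rw [DirectSum.decompose_zero]
  ext i
  exact h i

theorem mem_of_gradedProj_mem {S : Type*} [SetLike S M] [AddSubmonoidClass S M] (N : S) {x : M}
    (h : ∀ i, gradedProj 𝓜 i x ∈ N) : x ∈ N := by
  classical
  rw [← DirectSum.sum_support_decompose 𝓜 x]
  exact sum_mem fun i _ => h i

theorem map_gradedProj {N : Type*} [AddCommGroup N] [Module k N] (𝓝 : ℤ → Submodule k N)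
    [DirectSum.Decomposition 𝓝] (f : M →ₗ[k] N) (hf : ∀ i, ∀ x ∈ 𝓜 i, f x ∈ 𝓝 i) (i : ℤ) (x : M) :
    f (gradedProj 𝓜 i x) = gradedProj 𝓝 i (f x) := by
  induction x using DirectSum.Decomposition.inductionOn 𝓜 with
  | zero => simp
  | add a b ha hb => simp only [map_add, ha, hb]
  | @homogeneous j m =>
    rcases eq_or_ne j i with rfl | h
    · rw [gradedProj_of_mem _ m.2, gradedProj_of_mem _ (hf _ _ m.2)]
    · rw [gradedProj_of_mem_ne _ m.2 h, gradedProj_of_mem_ne _ (hf _ _ m.2) h, map_zero]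

/-- Starting point of the descending induction on degrees in `standardMap_injective`. -/
theorem exists_gradedProj_eq_zero_of_le (x : M) : ∃ n : ℤ, ∀ i, n ≤ i → gradedProj 𝓜 i x = 0 := by
  induction x using DirectSum.Decomposition.inductionOn 𝓜 with
  | zero => exact ⟨0, fun i _ => map_zero _⟩
  | @homogeneous j m => exact ⟨j + 1, fun i hi => gradedProj_of_mem_ne 𝓜 m.2 (by omega)⟩
  | add a b ha hb =>
    obtain ⟨n, hn⟩ := ha
    obtain ⟨m, hm⟩ := hb
    exact ⟨max n m, fun i hi => by
      rw [map_add, hn i (le_trans (le_max_left _ _) hi), hm i (le_trans (le_max_right _ _) hi),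
        add_zero]⟩

/-- The homogeneous component of a combination of homogeneous elements. -/
theorem gradedProj_linearCombination {B : Type*} (deg : B → ℤ) (z : B → M)
    (hz : ∀ b, z b ∈ 𝓜 (deg b)) (c : B →₀ k) (n : ℤ) :
    gradedProj 𝓜 n (Finsupp.linearCombination k z c) =
      Finsupp.linearCombination k z (c.filter fun b => deg b = n) := by
  induction c using Finsupp.induction_linear with
  | zero => rw [Finsupp.filter_zero, map_zero, map_zero]
  | add f g hf hg => rw [map_add, map_add, hf, hg, Finsupp.filter_add, map_add]
  | single b r =>
    rw [Finsupp.linearCombination_single, map_smul]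
    by_cases h : deg b = n
    · rw [Finsupp.filter_single_of_pos (fun b => deg b = n) h, Finsupp.linearCombination_single,
        ← h, gradedProj_of_mem 𝓜 (hz b)]
    · rw [Finsupp.filter_single_of_neg (fun b => deg b = n) h, map_zero,
        gradedProj_of_mem_ne 𝓜 (hz b) h, smul_zero]

/-- A family of projections determines a decomposition. -/
@[reducible]
noncomputable def decompositionOfProj {N : Type*} [AddCommGroup N] [Module k N]
    (𝓝 : ℤ → Submodule k N) (p : ℤ → N →ₗ[k] N)
    (hsame : ∀ i, ∀ x ∈ 𝓝 i, p i x = x) (hne : ∀ i j, i ≠ j → ∀ x ∈ 𝓝 i, p j x = 0)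
    (htop : ∀ x, x ∈ ⨆ i, 𝓝 i) : DirectSum.Decomposition 𝓝 := by
  classical
  refine DirectSum.IsInternal.chooseDecomposition 𝓝
    (DirectSum.isInternal_submodule_of_iSupIndep_of_iSup_eq_top ?_ (eq_top_iff.2 fun x _ => htop x))
  rw [iSupIndep_def]
  intro i
  rw [Submodule.disjoint_def]
  intro x hx hx'
  rw [← hsame i x hx]
  have hle : (⨆ j, ⨆ (_ : j ≠ i), 𝓝 j) ≤ LinearMap.ker (p i) :=
    iSup₂_le fun j hj y hy => hne j i hj y hy
  exact hle hx'

end GradedProjection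

section GradedRing

variable {k R : Type*} [Field k] [Ring R] [Algebra k R] (𝓡 : ℤ → Submodule k R)
  [GradedAlgebra 𝓡]

theorem gradedProj_mul_of_right_mem {j : ℤ} (a : R) {b : R} (hb : b ∈ 𝓡 j) (n : ℤ) :
    gradedProj 𝓡 n (a * b) = gradedProj 𝓡 (n - j) a * b := by
  have h := DirectSum.coe_decompose_mul_add_of_right_mem (i := n - j) 𝓡 (a := a) hb
  rwa [sub_add_cancel] at h

end GradedRing

/-! ### Connected graded algebras -/

/-- The graded algebra `R` is connected: it vanishes in negative degrees, and `R^0 = k` via the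
augmentation `π`. -/
structure IsConnectedGraded {k R : Type*} [Field k] [Ring R] [Algebra k R]
    (𝓡 : ℤ → Submodule k R) (π : R →ₐ[k] k) : Prop where
  eq_zero_of_neg : ∀ i < 0, ∀ x ∈ 𝓡 i, x = 0
  algebraMap_augmentation : ∀ x ∈ 𝓡 0, algebraMap k R (π x) = x
  augmentation_eq_zero : ∀ i, i ≠ 0 → ∀ x ∈ 𝓡 i, π x = 0

/-- `v` is a minimal family of homogeneous generators of the left ideal `ker π`. -/
structure IsMinimalGenerators {k R T : Type*} [Field k] [Ring R] [Algebra k R]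
    (𝓡 : ℤ → Submodule k R) (π : R →ₐ[k] k) (deg : T → ℤ) (v : T → R) : Prop where
  deg_pos : ∀ t, 0 < deg t
  mem : ∀ t, v t ∈ 𝓡 (deg t)
  mem_span : ∀ x, π x = 0 → x ∈ Submodule.span R (Set.range v)
  minimal : ∀ h : T →₀ R, Finsupp.linearCombination R v h = 0 → ∀ t, π (h t) = 0

/-! ### Graded Nakayama arguments -/

namespace IsConnectedGraded

variable {k R : Type u} [Field k] [Ring R] [Algebra k R] {𝓡 : ℤ → Submodule k R}
  [GradedAlgebra 𝓡] {π : R →ₐ[k] k} (hR : IsConnectedGraded 𝓡 π)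

include hR

theorem gradedProj_zero (x : R) : gradedProj 𝓡 0 x = algebraMap k R (π x) := by
  induction x using DirectSum.Decomposition.inductionOn 𝓡 with
  | zero => simp
  | add a b ha hb => rw [map_add, map_add, map_add, ha, hb]
  | @homogeneous j m =>
    rcases eq_or_ne j 0 with rfl | hj
    · rw [gradedProj_of_mem 𝓡 m.2, hR.algebraMap_augmentation _ m.2]
    · rw [gradedProj_of_mem_ne 𝓡 m.2 hj, hR.augmentation_eq_zero j hj _ m.2, map_zero]

theorem gradedProj_of_nonpos {x : R} (hx : π x = 0) {i : ℤ} (hi : i ≤ 0) :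
    gradedProj 𝓡 i x = 0 := by
  rcases hi.lt_or_eq with hi | rfl
  · exact hR.eq_zero_of_neg i hi _ (gradedProj_mem 𝓡 i x)
  · rw [hR.gradedProj_zero, hx, map_zero]

/-- Graded Nakayama: lift a homogeneous `k`-basis of `I / I²`. It generates `I` by induction on the
degree, because both factors of a product in `I²` have only components of positive degree. Reducing
a relation modulo `I²` leaves a `k`-linear relation with coefficients `π (h t)`, which must vanish.
-/
theorem exists_isMinimalGenerators :
    ∃ (T : Type u) (deg : T → ℤ) (v : T → R), IsMinimalGenerators 𝓡 π deg v := by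
  classical
  let I : Submodule k R := LinearMap.ker π.toLinearMap
  have memI : ∀ {x}, x ∈ I ↔ π x = 0 := Iff.rfl
  obtain ⟨b, hbs, hspan, hli⟩ := exists_linearIndependent k
    ((I * I).mkQ '' {x | ∃ i : ℤ, 0 < i ∧ x ∈ 𝓡 i})
  choose v hv hvq using fun t : b => hbs t.2
  choose deg hdeg hmem using hv
  have hvI : ∀ t, v t ∈ I := fun t => hR.augmentation_eq_zero _ (hdeg t).ne' _ (hmem t)
  refine ⟨b, deg, v, hdeg, hmem, ?_, ?_⟩
  · set J := Submodule.span R (Set.range v)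
    have hvJ : ∀ t, v t ∈ J := fun t => Submodule.subset_span ⟨t, rfl⟩
    have hom : ∀ m : ℕ, ∀ i : ℤ, 0 < i → i < m → ∀ x ∈ 𝓡 i, x ∈ J := by
      intro m
      induction m with
      | zero => intro i hi hi'; push_cast at hi'; omega
      | succ m ih =>
        intro n hn hnm x hx
        have h1 : (I * I).mkQ x ∈ Submodule.span k (b : Set (R ⧸ (I * I))) := by
          rw [hspan]
          exact Submodule.subset_span ⟨x, ⟨n, hn, hx⟩, rfl⟩
        have h2 : Set.range (fun t : b => (I * I).mkQ (v t)) = b := by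
          ext y
          constructor
          · rintro ⟨t, rfl⟩
            exact (congrArg (· ∈ b) (hvq t)).mpr t.2
          · exact fun hy => ⟨⟨y, hy⟩, hvq ⟨y, hy⟩⟩
        rw [← h2, ← Finsupp.range_linearCombination] at h1
        obtain ⟨c, hc⟩ := h1
        have h3 : x - Finsupp.linearCombination k v c ∈ I * I := by
          rw [← Submodule.Quotient.mk_eq_zero, ← Submodule.mkQ_apply, map_sub, ← hc, sub_eq_zero,
            Finsupp.apply_linearCombination]
          rfl
        have h4 : gradedProj 𝓡 n (Finsupp.linearCombination k v c) ∈ J := by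
          rw [gradedProj_linearCombination 𝓡 deg v hmem]
          exact sum_mem fun t _ => Submodule.smul_mem (J.restrictScalars k) _ (hvJ t)
        -- In degree `n` a product `p * q` is the sum of the `p_(n-j) * q_j`. Only `0 < j < n`
        -- contributes, and there `q_j` lies in `J` by induction.
        have h5 : ∀ y ∈ I * I, gradedProj 𝓡 n y ∈ J := by
          intro y hy
          induction hy using Submodule.mul_induction_on' with
          | add y _ z _ hy hz => rw [map_add]; exact add_mem hy hz
          | mem_mul_mem p hp q hq =>
            have hq' : q = ∑ i ∈ (decompose 𝓡 q).support, gradedProj 𝓡 i q :=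
              (DirectSum.sum_support_decompose 𝓡 q).symm
            rw [hq', Finset.mul_sum, map_sum]
            refine sum_mem fun j _ => ?_
            rw [gradedProj_mul_of_right_mem 𝓡 p (gradedProj_mem 𝓡 j q)]
            rcases le_or_gt j 0 with hj | hj
            · rw [hR.gradedProj_of_nonpos (memI.1 hq) hj, mul_zero]
              exact zero_mem _
            · rcases le_or_gt n j with hj' | hj'
              · rw [hR.gradedProj_of_nonpos (memI.1 hp) (by omega), zero_mul]
                exact zero_mem _
              · exact J.smul_mem _ (ih j hj (by push_cast at hnm; omega) _ (gradedProj_mem 𝓡 j q))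
        have h6 := h5 _ h3
        rw [map_sub, gradedProj_of_mem 𝓡 hx] at h6
        simpa using add_mem h6 h4
    intro x hx
    refine mem_of_gradedProj_mem 𝓡 J fun i => ?_
    rcases le_or_gt i 0 with hi | hi
    · rw [hR.gradedProj_of_nonpos hx hi]
      exact zero_mem _
    · exact hom (i.toNat + 1) i hi (by omega) _ (gradedProj_mem 𝓡 i x)
  · intro h hh
    let c : b →₀ k := h.mapRange π (map_zero π)
    have h1 : Finsupp.linearCombination k v c ∈ I * I := by
      -- Split each coefficient of the relation into its augmentation and a remainder in `I`; the
      -- remainders multiply the `v t` into `I²`.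
      have : Finsupp.linearCombination k v c = - (h.sum fun t r => (r - algebraMap k R (π r)) * v t) := by
        have e1 : (h.sum fun t r => (r - algebraMap k R (π r)) * v t) =
            Finsupp.linearCombination R v h - h.sum fun t r => π r • v t := by
          rw [Finsupp.linearCombination_apply, ← Finsupp.sum_sub]
          simp only [sub_mul, smul_eq_mul, Algebra.smul_def]
        rw [e1, hh, zero_sub, neg_neg, Finsupp.linearCombination_apply, Finsupp.sum_mapRange_index]
        simp
      rw [this]
      refine neg_mem (sum_mem fun t _ => Submodule.mul_mem_mul ?_ (hvI t))
      rw [memI, map_sub, AlgHom.commutes, Algebra.algebraMap_self, RingHom.id_apply, sub_self]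
    have h2 : Finsupp.linearCombination k (fun t : b => (t : R ⧸ (I * I))) c = 0 := by
      rw [← LinearMap.mem_ker.1 (show _ ∈ LinearMap.ker (I * I).mkQ by
        rw [Submodule.ker_mkQ]; exact h1), Finsupp.apply_linearCombination]
      congr 2
      exact funext fun t => (hvq t).symm
    have h3 := linearIndependent_iff.1 hli c h2
    intro t
    exact DFunLike.congr_fun h3 t

/-- A matrix congruent to the identity modulo the augmentation ideal is left regular. -/
theorem eq_zero_of_sum_smul_eq_zero {T : Type*} (b : T → T →₀ R)
    (hb : ∀ t s, π (b t s - Finsupp.single t 1 s) = 0) (h : T →₀ R)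
    (hh : Finsupp.linearCombination R b h = 0) : h = 0 := by
  classical
  have key : ∀ n : ℕ, ∀ i : ℤ, i < n → ∀ t, gradedProj 𝓡 i (h t) = 0 := by
    intro n
    induction n with
    | zero => exact fun i hi t => hR.eq_zero_of_neg i (by simpa using hi) _ (gradedProj_mem 𝓡 i _)
    | succ n ih =>
      intro i hi s
      -- From `h b = 0` follows `h = -h (b - 1)`. The entries of `b - 1` have only positive degrees,
      -- so the degree `i` part of `h` is expressed through its parts of lower degree.
      have e1 : h s = - h.sum fun t r => r * (b t s - Finsupp.single t 1 s) := by
        have e2 : (h.sum fun t r => r * b t s) = 0 := by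
          have := DFunLike.congr_fun hh s
          rw [Finsupp.linearCombination_apply, Finsupp.sum_apply] at this
          simpa using this
        have e3 : (h.sum fun t r => r * Finsupp.single t (1 : R) s) = h s := by
          simp [Finsupp.single_apply, Finsupp.sum, eq_comm]
        simp only [mul_sub]
        rw [Finsupp.sum_sub, e2, e3, zero_sub, neg_neg]
      rw [e1, map_neg, Finsupp.sum, map_sum, Finset.sum_eq_zero, neg_zero]
      intro t _
      have hq' : b t s - Finsupp.single t 1 s =
          ∑ j ∈ (decompose 𝓡 (b t s - Finsupp.single t 1 s)).support,
            gradedProj 𝓡 j (b t s - Finsupp.single t 1 s) :=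
        (DirectSum.sum_support_decompose 𝓡 _).symm
      rw [hq', Finset.mul_sum, map_sum, Finset.sum_eq_zero]
      intro j _
      rw [gradedProj_mul_of_right_mem 𝓡 _ (gradedProj_mem 𝓡 j _)]
      rcases le_or_gt j 0 with hj | hj
      · rw [hR.gradedProj_of_nonpos (hb t s) hj, mul_zero]
      · rw [ih (i - j) (by push_cast at hi; omega), zero_mul]
  ext t
  exact eq_zero_of_gradedProj 𝓡 fun i => key (i.toNat + 1) i (by omega) t

end IsConnectedGraded

/-! ### The standard resolution -/

section StandardMap

variable {k R T B : Type*} [Field k] [Ring R] [Algebra k R]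

/-- Extension of scalars on coefficients. -/
noncomputable def extendScalars (R : Type*) {k B : Type*} [Field k] [Ring R] [Algebra k R] :
    (B →₀ k) →ₗ[k] B →₀ R :=
  Finsupp.mapRange.linearMap (Algebra.linearMap k R)

@[simp]
theorem extendScalars_apply (c : B →₀ k) (b : B) :
    extendScalars R c b = algebraMap k R (c b) := rfl

@[simp]
theorem extendScalars_single (b : B) (c : k) :
    extendScalars R (Finsupp.single b c) = Finsupp.single b (algebraMap k R c) := by
  simp [extendScalars]

theorem linearCombination_extendScalars {M : Type*} [AddCommGroup M] [Module k M] [Module R M]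
    [IsScalarTower k R M] (z : B → M) (c : B →₀ k) :
    Finsupp.linearCombination R z (extendScalars R c) = Finsupp.linearCombination k z c := by
  induction c using Finsupp.induction_linear with
  | zero => simp
  | add f g hf hg => simp only [map_add, hf, hg]
  | single b r => simp

/-- The relation `v t ⊗ b - ρ t b` in the free module on `B`. -/
noncomputable def standardRelation (v : T → R) (ρ : T → B → B →₀ k) (tb : T × B) : B →₀ R :=
  Finsupp.single tb.2 (v tb.1) - extendScalars R (ρ tb.1 tb.2)

/-- The first map of the standard resolution. -/
noncomputable def standardMap (v : T → R) (ρ : T → B → B →₀ k) :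
    (T × B →₀ R) →ₗ[R] B →₀ R :=
  Finsupp.linearCombination R (standardRelation v ρ)

/-- The coefficients of `y` at the pairs `(t, b)` for a fixed `b`. -/
noncomputable def fiber (b : B) : (T × B →₀ R) →ₗ[R] T →₀ R :=
  Finsupp.lcomapDomain (fun t => (t, b)) fun _ _ h => (Prod.mk.inj h).1

@[simp]
theorem fiber_apply (b : B) (y : T × B →₀ R) (t : T) : fiber b y t = y (t, b) := rfl

/-- Separates the part that raises the degree of the coefficients, by multiplication with `v t`,
from the part with scalars in `k`, which preserves it. -/
theorem standardMap_apply (v : T → R) (ρ : T → B → B →₀ k) (y : T × B →₀ R) (b : B) :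
    standardMap v ρ y b = Finsupp.linearCombination R v (fiber b y) - y.sum fun tb r => ρ tb.1 tb.2 b • r := by
  classical
  induction y using Finsupp.induction_linear with
  | zero => simp
  | add f g hf hg =>
    rw [map_add, Finsupp.add_apply, hf, hg, map_add, map_add,
      Finsupp.sum_add_index' (by simp) (by simp)]
    abel
  | single tb r =>
    obtain ⟨t, b'⟩ := tb
    rw [Finsupp.sum_single_index (by simp), standardMap, Finsupp.linearCombination_single,
      standardRelation, smul_sub, Finsupp.sub_apply, Finsupp.smul_apply, Finsupp.smul_apply,
      extendScalars_apply, smul_eq_mul, smul_eq_mul,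
      ← Algebra.commutes _ r, ← Algebra.smul_def]
    congr 1
    by_cases h : b' = b
    · subst h
      have : fiber b' (Finsupp.single (t, b') r) = Finsupp.single t r := by
        ext s
        simp [Finsupp.single_apply]
      rw [this]
      simp
    · have : fiber b (Finsupp.single (t, b') r) = 0 := by
        ext s
        simp [h]
      rw [this, Finsupp.single_eq_of_ne (Ne.symm h)]
      simp

end StandardMap

/-! ### Exactness of the standard resolution -/

namespace IsMinimalGenerators

variable {k R T : Type u} [Field k] [Ring R] [Algebra k R] {𝓡 : ℤ → Submodule k R}
  {π : R →ₐ[k] k} {deg : T → ℤ} {v : T → R} (hv : IsMinimalGenerators 𝓡 π deg v)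

include hv

theorem augmentation_eq_zero (hR : IsConnectedGraded 𝓡 π) (t : T) : π (v t) = 0 :=
  hR.augmentation_eq_zero _ (hv.deg_pos t).ne' _ (hv.mem t)

theorem ne_zero (t : T) : v t ≠ 0 := by
  intro h
  have := hv.minimal (Finsupp.single t 1) (by simp [h]) t
  simp at this

variable [GradedAlgebra 𝓡]

/-- Leading-term argument, valid for every `ρ`. Give the degree `i` part of the coefficient at `(t,
b)` the weight `i + deg t`. Multiplication by `v t` puts it in degree `i + deg t`, while the
`ρ`-term stays in the smaller degree `i`. Hence the part of `y` of highest weight is a relation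
among the `v t`, and it vanishes. -/
theorem standardMap_injective (hli : LinearIndependent R v) {B : Type*} (ρ : T → B → B →₀ k) :
    Function.Injective (standardMap v ρ) := by
  classical
  rw [injective_iff_map_eq_zero]
  intro y hy
  have bound : ∃ N : ℤ, ∀ i t b, N ≤ i + deg t → gradedProj 𝓡 i (y (t, b)) = 0 := by
    clear hy
    induction y using Finsupp.induction_linear with
    | zero => exact ⟨0, by simp⟩
    | add f g hf hg =>
      obtain ⟨n, hn⟩ := hf
      obtain ⟨m, hm⟩ := hg
      exact ⟨max n m, fun i t b hi => by
        rw [Finsupp.add_apply, map_add, hn i t b (le_trans (le_max_left _ _) hi),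
          hm i t b (le_trans (le_max_right _ _) hi), add_zero]⟩
    | single tb r =>
      obtain ⟨n, hn⟩ := exists_gradedProj_eq_zero_of_le 𝓡 r
      refine ⟨n + deg tb.1, fun i t b hi => ?_⟩
      by_cases h : tb = (t, b)
      · subst h
        rw [Finsupp.single_eq_same]
        exact hn i (by simpa using hi)
      · rw [Finsupp.single_eq_of_ne (Ne.symm h), map_zero]
  obtain ⟨N, hN⟩ := bound
  -- Descending induction on the weight, starting from the bound `N`.
  have key : ∀ n : ℕ, ∀ i t b, N - n ≤ i + deg t → gradedProj 𝓡 i (y (t, b)) = 0 := by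
    intro n
    induction n with
    | zero => simpa using hN
    | succ n ih =>
      intro i t b hi
      by_cases hi' : N - n ≤ i + deg t
      · exact ih i t b hi'
      set m := i + deg t with hm
      have e1 := congrArg (gradedProj 𝓡 m) (DFunLike.congr_fun hy b)
      rw [standardMap_apply, Finsupp.zero_apply, map_zero, map_sub, sub_eq_zero] at e1
      -- A degree `m` part of a coefficient at `tb` has weight `m + deg tb.1 > m`, so it is already
      -- known to vanish.
      have e2 : gradedProj 𝓡 m (y.sum fun tb r => ρ tb.1 tb.2 b • r) = 0 := by
        rw [Finsupp.sum, map_sum]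
        refine Finset.sum_eq_zero fun tb _ => ?_
        rw [map_smul, ih m tb.1 tb.2 (by have := hv.deg_pos tb.1; push_cast at hi; omega),
          smul_zero]
      rw [e2] at e1
      set w := fiber b y with hw
      have e3 : gradedProj 𝓡 m (Finsupp.linearCombination R v w) =
          ∑ s ∈ w.support, gradedProj 𝓡 (m - deg s) (w s) • v s := by
        rw [Finsupp.linearCombination_apply, Finsupp.sum, map_sum]
        exact Finset.sum_congr rfl fun s _ => gradedProj_mul_of_right_mem 𝓡 _ (hv.mem s) m
      rw [e3] at e1
      have e4 := linearIndependent_iff'.1 hli _ _ e1 t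
      by_cases ht : t ∈ w.support
      · have := e4 ht
        rwa [hm, add_sub_cancel_right] at this
      · have : y (t, b) = 0 := by simpa [hw] using ht
        rw [this, map_zero]
  ext tb
  refine eq_zero_of_gradedProj 𝓡 fun i => key (N - (i + deg tb.1)).toNat i tb.1 tb.2 (by omega)

/-- Modulo the image, `g v_t ⊗ b` equals `g ρ(t, b)`, whose coefficients have degree smaller by `deg
t`. Rewriting ends with coefficients of degree 0, which are scalars. -/
theorem exists_standardMap_add (hR : IsConnectedGraded 𝓡 π) {B : Type*} (ρ : T → B → B →₀ k)
    (x : B →₀ R) : ∃ (y : T × B →₀ R) (n : B →₀ k), x = standardMap v ρ y + extendScalars R n := by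
  classical
  let S : Submodule k (B →₀ R) := LinearMap.range ((standardMap v ρ).restrictScalars k) ⊔
    LinearMap.range (extendScalars R)
  have hom : ∀ m : ℕ, ∀ i : ℤ, i < m → ∀ r ∈ 𝓡 i, ∀ b, Finsupp.single b r ∈ S := by
    intro m
    induction m with
    | zero =>
      intro i hi r hr b
      rw [hR.eq_zero_of_neg i (by simpa using hi) r hr, Finsupp.single_zero]
      exact zero_mem _
    | succ m ih =>
      intro i hi r hr b
      rcases lt_trichotomy i 0 with hi0 | rfl | hi0
      · rw [hR.eq_zero_of_neg i hi0 r hr, Finsupp.single_zero]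
        exact zero_mem _
      · refine Submodule.mem_sup_right ⟨Finsupp.single b (π r), ?_⟩
        rw [extendScalars_single, hR.algebraMap_augmentation r hr]
      · have h1 := hv.mem_span r (hR.augmentation_eq_zero i hi0.ne' r hr)
        rw [← Finsupp.range_linearCombination] at h1
        obtain ⟨h, hh⟩ := h1
        -- The coefficients `h t` may be replaced by their components of degree `i - deg t`, since
        -- `r` and the `v t` are homogeneous.
        have e : r = ∑ t ∈ h.support, gradedProj 𝓡 (i - deg t) (h t) * v t := by
          rw [← gradedProj_of_mem 𝓡 hr, ← hh, Finsupp.linearCombination_apply, Finsupp.sum, map_sum]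
          exact Finset.sum_congr rfl fun s _ => gradedProj_mul_of_right_mem 𝓡 _ (hv.mem s) i
        rw [e, Finsupp.single_finsetSum]
        refine sum_mem fun t _ => ?_
        set g := gradedProj 𝓡 (i - deg t) (h t) with hg
        have e2 : Finsupp.single b (g * v t) =
            standardMap v ρ (Finsupp.single (t, b) g) + g • extendScalars R (ρ t b) := by
          rw [standardMap, Finsupp.linearCombination_single, standardRelation, smul_sub,
            sub_add_cancel, Finsupp.smul_single, smul_eq_mul]
        rw [e2]
        refine add_mem (Submodule.mem_sup_left ⟨_, rfl⟩) ?_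
        have e3 : g • extendScalars R (ρ t b) =
            (ρ t b).sum fun b' c => c • Finsupp.single b' g := by
          ext b'
          rw [Finsupp.sum_apply, Finsupp.smul_apply, extendScalars_apply, smul_eq_mul,
            ← Algebra.commutes, ← Algebra.smul_def]
          simp [Finsupp.single_apply, Finsupp.sum]
          intro h
          simp [h]
        rw [e3]
        refine sum_mem fun b' _ => S.smul_mem _ (ih (i - deg t) ?_ _ (gradedProj_mem 𝓡 _ _) b')
        have := hv.deg_pos t
        push_cast at hi
        omega
  have hx : x ∈ S := by
    induction x using Finsupp.induction_linear with
    | zero => exact zero_mem _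
    | add f g hf hg => exact add_mem hf hg
    | single b r =>
      rw [← DirectSum.sum_support_decompose 𝓡 r, Finsupp.single_finsetSum]
      exact sum_mem fun i _ => hom (i.toNat + 1) i (by omega) _ (gradedProj_mem 𝓡 i r) b
  obtain ⟨_, ⟨y, rfl⟩, _, ⟨n, rfl⟩, h⟩ := Submodule.mem_sup.1 hx
  exact ⟨y, n, h.symm⟩

end IsMinimalGenerators

/-! ### Graded modules: free modules, kernels and the trivial module -/

section FreeGrading

variable {k R X : Type*} [Field k] [Ring R] [Algebra k R] (𝓡 : ℤ → Submodule k R) (deg : X → ℤ)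

/-- The grading of the free module with basis elements of degree `deg x`. -/
def freeGrading (i : ℤ) : Submodule k (X →₀ R) where
  carrier := {f | ∀ x, f x ∈ 𝓡 (i - deg x)}
  zero_mem' _ := zero_mem _
  add_mem' hf hg x := add_mem (hf x) (hg x)
  smul_mem' c _ hf x := Submodule.smul_mem _ c (hf x)

theorem single_mem_freeGrading {i : ℤ} {x : X} {r : R} (hr : r ∈ 𝓡 (i - deg x)) :
    Finsupp.single x r ∈ freeGrading 𝓡 deg i := by
  classical
  intro y
  rw [Finsupp.single_apply]
  split_ifs with h
  · exact h ▸ hr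
  · exact zero_mem _

variable [GradedAlgebra 𝓡]

theorem single_one_mem_freeGrading (x : X) :
    Finsupp.single x 1 ∈ freeGrading 𝓡 deg (deg x) :=
  single_mem_freeGrading 𝓡 deg (by rw [sub_self]; exact SetLike.GradedOne.one_mem)

/-- The projections of a graded free module on its components. -/
noncomputable def freeProj (i : ℤ) : (X →₀ R) →ₗ[k] X →₀ R :=
  Finsupp.lsum k fun x => Finsupp.lsingle x ∘ₗ gradedProj 𝓡 (i - deg x)

theorem freeProj_apply (i : ℤ) (f : X →₀ R) (x : X) :
    freeProj 𝓡 deg i f x = gradedProj 𝓡 (i - deg x) (f x) := by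
  classical
  induction f using Finsupp.induction_linear with
  | zero => simp
  | add f g hf hg => simp only [map_add, Finsupp.add_apply, hf, hg]
  | single y r =>
    simp only [freeProj, Finsupp.lsum_single, LinearMap.comp_apply, Finsupp.lsingle_apply]
    by_cases h : y = x
    · subst h
      simp
    · simp [Finsupp.single_eq_of_ne (Ne.symm h)]

noncomputable instance freeDecomposition : DirectSum.Decomposition (freeGrading (X := X) 𝓡 deg) :=
  decompositionOfProj _ (freeProj 𝓡 deg)
    (fun i f hf => by ext x; rw [freeProj_apply, gradedProj_of_mem 𝓡 (hf x)])
    (fun i j hij f hf => by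
      ext x
      rw [freeProj_apply, gradedProj_of_mem_ne 𝓡 (hf x) (by omega)]
      rfl)
    (fun f => by
      classical
      induction f using Finsupp.induction_linear with
      | zero => exact zero_mem _
      | add f g hf hg => exact add_mem hf hg
      | single x r =>
        rw [← DirectSum.sum_support_decompose 𝓡 r, Finsupp.single_finsetSum]
        refine sum_mem fun i _ => Submodule.mem_iSup_of_mem (i + deg x) ?_
        exact single_mem_freeGrading 𝓡 deg (by rw [add_sub_cancel_right]; exact (decompose 𝓡 r i).2))

theorem smul_mem_freeGrading (i j : ℤ) (r : R) (f : X →₀ R) (hr : r ∈ 𝓡 i)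
    (hf : f ∈ freeGrading 𝓡 deg j) : r • f ∈ freeGrading 𝓡 deg (i + j) := fun x => by
  rw [add_sub_assoc]
  exact SetLike.GradedMul.mul_mem hr (hf x)

end FreeGrading

namespace GrModule

variable {k R : Type u} [Field k] [Ring R] [Algebra k R] {𝓡 : ℤ → Submodule k R}

theorem Hom.map_gradedProj {M N : GrModule 𝓡} (f : Hom M N) (i : ℤ) (x : M) :
    f.toLinearMap (gradedProj M.gr i x) = gradedProj N.gr i (f.toLinearMap x) :=
  _root_.map_gradedProj M.gr N.gr (f.toLinearMap.restrictScalars k) f.map_mem i x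

/-- Composition of morphisms. -/
def Hom.comp {M N P : GrModule 𝓡} (g : Hom N P) (f : Hom M N) : Hom M P where
  toLinearMap := g.toLinearMap ∘ₗ f.toLinearMap
  map_mem i m hm := g.map_mem i _ (f.map_mem i m hm)

/-- The inverse of a bijective morphism. -/
noncomputable def Hom.inverse {M N : GrModule 𝓡} (f : Hom M N)
    (hf : Function.Bijective f.toLinearMap) : Hom N M where
  toLinearMap := (LinearEquiv.ofBijective f.toLinearMap hf).symm.toLinearMap
  map_mem i m hm := by
    let e := LinearEquiv.ofBijective f.toLinearMap hf
    obtain ⟨x, rfl⟩ := hf.2 m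
    change e.symm (e x) ∈ M.gr i
    rw [e.symm_apply_apply]
    have : gradedProj M.gr i x = x := hf.1 (by rw [f.map_gradedProj, gradedProj_of_mem _ hm])
    rw [← this]
    exact gradedProj_mem _ i x

theorem IsProjective.of_bijective {M N : GrModule 𝓡} (hM : M.IsProjective) (f : Hom M N)
    (hf : Function.Bijective f.toLinearMap) : N.IsProjective := by
  intro P Q g h hg
  obtain ⟨l, hl⟩ := hM P Q g (h.comp f) hg
  refine ⟨l.comp (f.inverse hf), fun x => ?_⟩
  have e := hl ((f.inverse hf).toLinearMap x)
  have e' : f.toLinearMap ((f.inverse hf).toLinearMap x) = x :=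
    (LinearEquiv.ofBijective f.toLinearMap hf).apply_symm_apply x
  exact e.trans (congrArg h.toLinearMap e')

/-- The kernel of a morphism. -/
@[reducible]
noncomputable def Hom.ker {M N : GrModule 𝓡} (f : Hom M N) : GrModule 𝓡 where
  carrier := LinearMap.ker f.toLinearMap
  gr i := (M.gr i).comap ((LinearMap.ker f.toLinearMap).subtype.restrictScalars k)
  decomposition := by
    classical
    let p (i : ℤ) : LinearMap.ker f.toLinearMap →ₗ[k] LinearMap.ker f.toLinearMap :=
      LinearMap.codRestrict ((LinearMap.ker f.toLinearMap).restrictScalars k)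
        (gradedProj M.gr i ∘ₗ (LinearMap.ker f.toLinearMap).subtype.restrictScalars k) (fun x => by
          change f.toLinearMap (gradedProj M.gr i x) = 0
          rw [f.map_gradedProj, x.2, map_zero])
    have hp : ∀ i x, (p i x : M) = gradedProj M.gr i x := fun _ _ => rfl
    refine decompositionOfProj _ p ?_ ?_ ?_
    · intro i x hx
      exact Subtype.ext ((hp i x).trans (gradedProj_of_mem _ hx))
    · intro i j hij x hx
      exact Subtype.ext ((hp j x).trans (gradedProj_of_mem_ne _ hx hij))
    · intro x
      have e : x = ∑ i ∈ (decompose M.gr (x : M)).support, p i x := by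
        apply Subtype.ext
        rw [AddSubmonoidClass.coe_finsetSum]
        exact (DirectSum.sum_support_decompose M.gr (x : M)).symm
      rw [e]
      exact sum_mem fun i _ => Submodule.mem_iSup_of_mem i (gradedProj_mem M.gr i (x : M))
  smul_mem i j r m hr hm := M.smul_mem i j r m hr hm

/-- The algebra as a graded module over itself. -/
@[reducible]
def regular (𝓡 : ℤ → Submodule k R) [GradedAlgebra 𝓡] : GrModule 𝓡 where
  carrier := R
  gr := 𝓡
  smul_mem _ _ _ _ hr hm := SetLike.GradedMul.mul_mem hr hm

/-- The free graded module with basis elements of degree `deg x`. -/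
@[reducible]
noncomputable def free (𝓡 : ℤ → Submodule k R) [GradedAlgebra 𝓡] {X : Type u} (deg : X → ℤ) :
    GrModule 𝓡 where
  carrier := X →₀ R
  gr := freeGrading 𝓡 deg
  decomposition := freeDecomposition 𝓡 deg
  smul_mem := smul_mem_freeGrading 𝓡 deg

/-- The trivial graded module. -/
noncomputable def trivial [GradedAlgebra 𝓡] {π : R →ₐ[k] k} (hR : IsConnectedGraded 𝓡 π) :
    GrModule 𝓡 :=
  letI : Module R k := Module.compHom k π.toRingHom
  have smul_eq : ∀ (a : R) (c : k), a • c = π a * c := fun _ _ => rfl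
  { carrier := k
    isScalarTower := ⟨fun c a x => by simp [smul_eq, mul_assoc]⟩
    gr := DGAlgebra.trivialGr k
    smul_mem := by
      intro i j a c ha hc
      rw [smul_eq]
      rcases eq_or_ne i 0 with rfl | hi
      · rw [zero_add]
        exact (DGAlgebra.trivialGr k j).smul_mem _ hc
      · rw [hR.augmentation_eq_zero i hi a ha, zero_mul]
        exact zero_mem _ }

variable [GradedAlgebra 𝓡]

/-- The morphism from a free module given by homogeneous elements. -/
noncomputable def freeLift {X : Type u} {deg : X → ℤ} {M : GrModule 𝓡} (m : X → M)
    (hm : ∀ x, m x ∈ M.gr (deg x)) : Hom (free 𝓡 deg) M where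
  toLinearMap := Finsupp.linearCombination R m
  map_mem i f hf := by
    change Finsupp.linearCombination R m f ∈ _
    rw [Finsupp.linearCombination_apply]
    refine sum_mem fun x _ => ?_
    have := M.smul_mem _ _ _ _ (hf x) (hm x)
    rwa [sub_add_cancel] at this

theorem free_isProjective {X : Type u} (deg : X → ℤ) : (free 𝓡 deg).IsProjective := by
  intro M N g f hg
  choose m' hm' using fun x : X => hg (f.toLinearMap (Finsupp.single x (1 : R)))
  -- The chosen preimages need not be homogeneous, but their components in the right degree still
  -- lift the basis elements.
  have hm : ∀ x, g.toLinearMap (gradedProj M.gr (deg x) (m' x)) =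
      f.toLinearMap (Finsupp.single x (1 : R)) := fun x => by
    rw [g.map_gradedProj, hm', gradedProj_of_mem]
    exact f.map_mem _ _ (single_one_mem_freeGrading 𝓡 deg x)
  refine ⟨freeLift (fun x => gradedProj M.gr (deg x) (m' x)) fun x => gradedProj_mem _ _ _, ?_⟩
  intro y
  have : g.toLinearMap ∘ₗ Finsupp.linearCombination R
      (fun x => gradedProj M.gr (deg x) (m' x)) = f.toLinearMap := by
    refine Finsupp.lhom_ext' fun x => LinearMap.ext_ring ?_
    simp only [LinearMap.comp_apply, Finsupp.lsingle_apply, Finsupp.linearCombination_single,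
      one_smul]
    exact hm x
  exact LinearMap.congr_fun this y

omit [GradedAlgebra 𝓡] in
/-- A graded module has a basis of homogeneous elements over the base field. -/
theorem exists_homogeneous_basis (N : GrModule 𝓡) :
    ∃ (B : Type u) (deg : B → ℤ) (z : Module.Basis B k N), ∀ b, z b ∈ N.gr (deg b) := by
  classical
  obtain ⟨b, hbs, hspan, hli⟩ := exists_linearIndependent k {x : N | ∃ i : ℤ, x ∈ N.gr i}
  choose deg hdeg using fun t : b => hbs t.2
  refine ⟨b, deg, Module.Basis.mk hli ?_, fun t => by rw [Module.Basis.mk_apply]; exact hdeg t⟩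
  rw [Subtype.range_coe, hspan]
  intro x _
  exact mem_of_gradedProj_mem N.gr _ fun i => Submodule.subset_span ⟨i, gradedProj_mem _ i x⟩

omit [GradedAlgebra 𝓡] in
-- An infimum of natural numbers in `ℕ∞` that is finite is attained. The form with `m ≤ n` avoids
-- proving that `HasProjDimLE` is monotone in the length.
theorem projDim_le_iff {M : GrModule 𝓡} {n : ℕ} :
    M.projDim ≤ n ↔ ∃ m ≤ n, M.HasProjDimLE m := by
  constructor
  · intro h
    by_contra! hc
    have : ((n + 1 : ℕ) : ℕ∞) ≤ M.projDim := le_iInf₂ fun m hm => by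
      by_contra! hlt
      exact hc m (by have := Nat.cast_lt.1 hlt; omega) hm
    have h2 := this.trans h
    rw [Nat.cast_le] at h2
    omega
  · rintro ⟨m, hm, h⟩
    exact (iInf₂_le m h).trans (Nat.cast_le.2 hm)

end GrModule

/-! ### Projective dimension and minimal generators -/

namespace IsMinimalGenerators

open GrModule

variable {k R T : Type u} [Field k] [Ring R] [Algebra k R] {𝓡 : ℤ → Submodule k R}
  [GradedAlgebra 𝓡] {π : R →ₐ[k] k} {deg : T → ℤ} {v : T → R}
  (hv : IsMinimalGenerators 𝓡 π deg v)

include hv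

/-- The standard resolution of a graded module. -/
theorem exists_standardResolution (hR : IsConnectedGraded 𝓡 π) (hli : LinearIndependent R v)
    (N : GrModule 𝓡) : ∃ (B : Type u) (e : B → ℤ)
      (i : Hom (free 𝓡 fun tb : T × B => deg tb.1 + e tb.2) (free 𝓡 e)) (p : Hom (free 𝓡 e) N),
      Function.Injective i.toLinearMap ∧ Function.Surjective p.toLinearMap ∧
      LinearMap.range i.toLinearMap = LinearMap.ker p.toLinearMap := by
  classical
  obtain ⟨B, e, z, hz⟩ := N.exists_homogeneous_basis
  -- Coordinates of `v t • z b`. Filtering by degree leaves the combination unchanged, because that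
  -- element is homogeneous, and makes the relations visibly homogeneous.
  let ρ (t : T) (b : B) : B →₀ k := (z.repr (v t • z b)).filter fun b' => e b' = deg t + e b
  have hρ : ∀ t b, Finsupp.linearCombination k z (ρ t b) = v t • z b := fun t b => by
    rw [← gradedProj_linearCombination N.gr e z hz, z.linearCombination_repr,
      gradedProj_of_mem _ (N.smul_mem _ _ _ _ (hv.mem t) (hz b))]
  refine ⟨B, e, freeLift (M := free 𝓡 e) (standardRelation v ρ) ?_, freeLift z hz,
    hv.standardMap_injective hli ρ, ?_, ?_⟩
  · rintro ⟨t, b⟩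
    refine sub_mem (single_mem_freeGrading 𝓡 e ?_) ?_
    · simpa using hv.mem t
    · intro b'
      rw [extendScalars_apply]
      by_cases h : e b' = deg t + e b
      · rw [Algebra.algebraMap_eq_smul_one, h]
        refine Submodule.smul_mem _ _ ?_
        rw [sub_self]
        exact SetLike.GradedOne.one_mem
      · rw [show ρ t b b' = 0 from Finsupp.filter_apply_neg _ _ h, map_zero]
        exact zero_mem _
  · intro x
    refine ⟨extendScalars R (z.repr x), ?_⟩
    exact (linearCombination_extendScalars z _).trans (z.linearCombination_repr x)
  · have hcomp : Finsupp.linearCombination R z ∘ₗ standardMap v ρ = 0 := by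
      refine Finsupp.lhom_ext' fun tb => LinearMap.ext_ring ?_
      simp only [LinearMap.comp_apply, Finsupp.lsingle_apply, standardMap,
        Finsupp.linearCombination_single, one_smul, standardRelation, map_sub,
        linearCombination_extendScalars, hρ, sub_self, LinearMap.zero_apply]
    apply le_antisymm
    · rintro _ ⟨y, rfl⟩
      exact LinearMap.congr_fun hcomp y
    · intro x hx
      -- The remainder `n` has scalar coefficients and maps to zero in `N`; as `z` is a `k`-basis of
      -- `N`, it vanishes.
      obtain ⟨y, n, rfl⟩ := hv.exists_standardMap_add hR ρ x
      have h1 : Finsupp.linearCombination R z (standardMap v ρ y + extendScalars R n) = 0 := hx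
      rw [map_add, linearCombination_extendScalars,
        show Finsupp.linearCombination R z (standardMap v ρ y) = 0 from
          LinearMap.congr_fun hcomp y, zero_add] at h1
      have h2 : n = 0 := linearIndependent_iff.1 z.linearIndependent n h1
      refine ⟨y, ?_⟩
      subst h2
      exact (by simp : standardMap v ρ y = standardMap v ρ y + extendScalars R (0 : B →₀ k))

theorem projDim_le_one (hR : IsConnectedGraded 𝓡 π) (hli : LinearIndependent R v)
    (N : GrModule 𝓡) : N.projDim ≤ 1 := by
  obtain ⟨B, e, i, p, hi, hp, hip⟩ := hv.exists_standardResolution hR hli N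
  exact projDim_le_iff.2 ⟨1, le_rfl, _, _, i, p, hi, hp, hip, free_isProjective _,
    free_isProjective _⟩

/-- The left term of the standard resolution is zero, so `N` is free. -/
theorem projDim_eq_zero (hR : IsConnectedGraded 𝓡 π) [IsEmpty T] (N : GrModule 𝓡) :
    N.projDim = 0 := by
  obtain ⟨B, e, i, p, hi, hp, hip⟩ :=
    hv.exists_standardResolution hR linearIndependent_empty_type N
  refine nonpos_iff_eq_zero.1 (projDim_le_iff.2
    ⟨0, le_rfl, (free_isProjective e).of_bijective p ⟨LinearMap.ker_eq_bot.1 ?_, hp⟩⟩)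
  rw [← hip, eq_bot_iff]
  rintro _ ⟨y, rfl⟩
  have : y = 0 := Finsupp.ext (α := T × B) (M := R) fun tb => isEmptyElim tb.1
  rw [this, map_zero]
  exact zero_mem _

/-- The augmentation as a morphism of graded modules. -/
noncomputable def _root_.IsConnectedGraded.augmentationHom (hR : IsConnectedGraded 𝓡 π) :
    Hom (regular 𝓡) (GrModule.trivial hR) where
  toLinearMap :=
    { toFun := π
      map_add' := map_add π
      map_smul' := fun a b => map_mul π a b }
  map_mem i m hm := by
    change π m ∈ DGAlgebra.trivialGr k i
    rcases eq_or_ne i 0 with rfl | hi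
    · simp [DGAlgebra.trivialGr]
    · rw [hR.augmentation_eq_zero i hi m hm]
      exact zero_mem _

/-- A graded section of `R → k` must send `1` to `1`. Since `v t` annihilates `1` in `k`, it would
be zero in `R`, against minimality. -/
theorem isEmpty_of_isProjective (hR : IsConnectedGraded 𝓡 π)
    (hk : (GrModule.trivial hR).IsProjective) : IsEmpty T := by
  refine ⟨fun t => hv.ne_zero t ?_⟩
  obtain ⟨h, hh⟩ := hk _ _ hR.augmentationHom ⟨LinearMap.id, fun _ _ h => h⟩ (fun c =>
    ⟨algebraMap k R c, AlgHom.commutes π c⟩)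
  let c : R := h.toLinearMap (1 : k)
  have hc0 : c ∈ 𝓡 0 := h.map_mem 0 (1 : k) (by
    change (1 : k) ∈ DGAlgebra.trivialGr k 0
    simp [DGAlgebra.trivialGr])
  have hc1 : c = 1 := by
    rw [← hR.algebraMap_augmentation c hc0, show π c = 1 from hh (1 : k), map_one]
  have h1 : v t • (show GrModule.trivial hR from (1 : k)) = 0 := by
    change π (v t) * 1 = (0 : k)
    rw [hv.augmentation_eq_zero hR, zero_mul]
  have h2 : v t * c = 0 := by
    have := h.toLinearMap.map_smul (v t) (show GrModule.trivial hR from (1 : k))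
    rw [h1, map_zero] at this
    exact this.symm
  rwa [hc1, mul_one] at h2

/-- Given `0 → K → P → k → 0` with `K` and `P` projective, lift `P → k` to `f : P → R`, restrict to
`K → I`, and lift that to `g` from `K` to the free module on `T`. If `w` in `P` of degree 0 lies
over `1`, then `v t • w` comes from some `u t` in `K`, and `b t = g (u t)` satisfies `∑ b_ts v_s =
v_t`. So `b` is the identity modulo `I`. A relation `h` among the `v t` gives `∑ h_t u_t = 0` by
injectivity of `K → P`, hence `h b = 0` and `h = 0`. -/
theorem linearIndependent_of_projDim_le_one (hR : IsConnectedGraded 𝓡 π)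
    (hk : (GrModule.trivial hR).projDim ≤ 1) : LinearIndependent R v := by
  classical
  obtain ⟨m, hm, hd⟩ := (projDim_le_iff (n := 1)).1 hk
  interval_cases m
  · have := hv.isEmpty_of_isProjective hR hd
    exact linearIndependent_empty_type
  obtain ⟨K, P, i, p, hi, hp, hip, hP, hK : K.IsProjective⟩ := hd
  have hpi : ∀ x, p.toLinearMap (i.toLinearMap x) = 0 := fun x => by
    have : i.toLinearMap x ∈ LinearMap.ker p.toLinearMap := hip ▸ ⟨x, rfl⟩
    exact this
  obtain ⟨f, hf⟩ := hP _ _ hR.augmentationHom p (fun c =>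
    ⟨algebraMap k R c, AlgHom.commutes π c⟩)
  let I := hR.augmentationHom.ker
  let f' : Hom K I :=
    { toLinearMap := LinearMap.codRestrict _ (f.toLinearMap ∘ₗ i.toLinearMap) fun x =>
        (hf _).trans (hpi x)
      map_mem := fun j x hx => f.map_mem j _ (i.map_mem j x hx) }
  let q : Hom (free 𝓡 deg) I := freeLift (M := I)
    (fun t => ⟨v t, hv.augmentation_eq_zero hR t⟩) fun t => hv.mem t
  have hq : ∀ b : T →₀ R, (LinearMap.ker hR.augmentationHom.toLinearMap).subtype (q.toLinearMap b) =
      Finsupp.linearCombination R v b := fun b =>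
    Finsupp.apply_linearCombination R
      (LinearMap.ker hR.augmentationHom.toLinearMap).subtype _ b
  obtain ⟨g, hg⟩ := hK _ _ q f' (by
    rintro ⟨x, hx⟩
    have h1 := hv.mem_span x hx
    rw [← Finsupp.range_linearCombination] at h1
    obtain ⟨b, hb⟩ := h1
    exact ⟨b, Subtype.ext ((hq b).trans hb)⟩)
  obtain ⟨w', hw'⟩ := hp (1 : k)
  -- Degree 0 is what forces `f w = 1`, and not merely an element of augmentation 1.
  let w := gradedProj P.gr 0 w'
  have hw : p.toLinearMap w = (1 : k) := by
    rw [p.map_gradedProj, hw']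
    refine gradedProj_of_mem _ ?_
    change (1 : k) ∈ DGAlgebra.trivialGr k 0
    simp [DGAlgebra.trivialGr]
  have hfw : f.toLinearMap w = (1 : R) := by
    have h0 : (f.toLinearMap w : R) ∈ 𝓡 0 := f.map_mem 0 _ (gradedProj_mem _ _ _)
    have h1 : π (f.toLinearMap w) = (1 : k) := (hf w).trans hw
    exact (hR.algebraMap_augmentation _ h0).symm.trans (by rw [h1, map_one])
  have hu : ∀ t, ∃ u, i.toLinearMap u = v t • w := fun t => by
    change v t • w ∈ LinearMap.range i.toLinearMap
    rw [hip, LinearMap.mem_ker, map_smul, hw]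
    change π (v t) * (1 : k) = 0
    rw [hv.augmentation_eq_zero hR, zero_mul]
  choose u hu using hu
  let b (t : T) : T →₀ R := g.toLinearMap (u t)
  have hb : ∀ t, Finsupp.linearCombination R v (b t) = v t := fun t => by
    rw [← hq]
    have h1 : (q.toLinearMap (b t)) = f'.toLinearMap (u t) := hg (u t)
    rw [h1]
    change f.toLinearMap (i.toLinearMap (u t)) = v t
    rw [hu, map_smul, hfw]
    exact mul_one _
  rw [linearIndependent_iff]
  intro h hh
  refine hR.eq_zero_of_sum_smul_eq_zero b (fun t s => ?_) h ?_
  -- Row `t` of `b - 1` is a relation among the `v s`, so its entries lie in `I`.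
  · refine hv.minimal (b t - Finsupp.single t 1) ?_ s
    rw [map_sub, hb, Finsupp.linearCombination_single, one_smul, sub_self]
  · have h1 : Finsupp.linearCombination R u h = 0 := by
      apply hi
      rw [map_zero, Finsupp.apply_linearCombination]
      have : i.toLinearMap ∘ u = LinearMap.toSpanSingleton R P w ∘ v := funext fun t => hu t
      rw [this, ← Finsupp.apply_linearCombination, hh, map_zero]
    have h2 := congrArg g.toLinearMap h1
    rw [Finsupp.apply_linearCombination, map_zero] at h2
    exact h2

end IsMinimalGenerators

/-! ### The cohomology of a connected DG algebra -/

namespace DGAlgebra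

variable {k : Type u} [Field k] {A : DGAlgebra k}

theorem IsConnected.augmentation_d (hA : A.IsConnected) (x : A) : hA.augmentation (A.d x) = 0 := by
  induction x using DirectSum.Decomposition.inductionOn A.gr with
  | zero => simp
  | add a b ha hb => simp [ha, hb]
  | @homogeneous i m =>
    rcases eq_or_ne i (-1) with rfl | hi
    · have h : (m : A) = 0 := by
        have h := hA.gr_neg (-1) (by norm_num)
        exact (Submodule.mem_bot k).1 (h ▸ m.2)
      rw [h, map_zero, map_zero]
    · exact hA.augmentation_of_mem (i + 1) _ (A.d_mem i m m.2) (by omega)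

/-- The augmentation of the cohomology algebra. -/
noncomputable def IsConnected.cohomologyAugmentation (hA : A.IsConnected) :
    A.Cohomology →ₐ[k] k :=
  Ideal.Quotient.liftₐ A.coboundaries (hA.augmentation.comp A.cocycles.val) (by
    rintro a ⟨x, hx⟩
    change hA.augmentation (a : A) = 0
    rw [← hx, hA.augmentation_d])

theorem IsConnected.algebraMap_augmentation (hA : A.IsConnected) {a : A} (ha : a ∈ A.gr 0) :
    algebraMap k A (hA.augmentation a) = a :=
  (hA.algebraMap_scalar a).trans (decompose_of_mem_same _ ha)

theorem IsConnected.isConnectedGraded (hA : A.IsConnected) :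
    IsConnectedGraded A.cohomologyGr hA.cohomologyAugmentation where
  eq_zero_of_neg := by
    rintro i hi _ ⟨z, hz, rfl⟩
    have h : (z : A) ∈ A.gr i := hz
    rw [hA.gr_neg i hi, Submodule.mem_bot] at h
    rw [show z = 0 from Subtype.ext h, map_zero]
  algebraMap_augmentation := by
    rintro _ ⟨z, hz, rfl⟩
    change Ideal.Quotient.mk A.coboundaries (algebraMap k A.cocycles (hA.augmentation (z : A))) =
      Ideal.Quotient.mk A.coboundaries z
    congr 1
    exact Subtype.ext (hA.algebraMap_augmentation hz)
  augmentation_eq_zero := by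
    rintro i hi _ ⟨z, hz, rfl⟩
    exact hA.augmentation_of_mem i _ hz hi

end DGAlgebra

/-! ### The sign involution and the general Leibniz rule -/

namespace DGAlgebra

variable {k : Type u} [Field k] (A : DGAlgebra k)

/-- The automorphism `a ↦ (-1)^|a| a`. -/
noncomputable def sgn : A →ₗ[k] A :=
  DirectSum.toModule k ℤ A (fun i => (i.negOnePow : ℤ) • (A.gr i).subtype) ∘ₗ
    (DirectSum.decomposeLinearEquiv A.gr).toLinearMap

theorem sgn_of_mem {i : ℤ} {a : A} (ha : a ∈ A.gr i) : A.sgn a = i.negOnePow • a := by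
  lift a to A.gr i using ha
  simp only [sgn, LinearMap.comp_apply, LinearEquiv.coe_coe, DirectSum.decomposeLinearEquiv_apply,
    DirectSum.decompose_coe]
  exact DirectSum.toModule_lof (M := fun i => A.gr i) k
    (φ := fun i => (i.negOnePow : ℤ) • (A.gr i).subtype) i a

theorem sgn_mem {i : ℤ} {a : A} (ha : a ∈ A.gr i) : A.sgn a ∈ A.gr i := by
  rw [A.sgn_of_mem ha, Units.smul_def]
  exact zsmul_mem ha _

@[simp]
theorem sgn_sgn (a : A) : A.sgn (A.sgn a) = a := by
  induction a using DirectSum.Decomposition.inductionOn A.gr with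
  | zero => simp
  | add a b ha hb => simp [ha, hb]
  | @homogeneous i m =>
    rw [A.sgn_of_mem m.2, Units.smul_def, map_zsmul, A.sgn_of_mem m.2, Units.smul_def, smul_smul,
      ← Units.val_mul]
    simp

theorem sgn_mul (a b : A) : A.sgn (a * b) = A.sgn a * A.sgn b := by
  induction a using DirectSum.Decomposition.inductionOn A.gr with
  | zero => simp
  | add a a' ha ha' => simp only [add_mul, map_add, ha, ha']
  | @homogeneous i a =>
    induction b using DirectSum.Decomposition.inductionOn A.gr with
    | zero => simp
    | add b b' hb hb' => simp only [mul_add, map_add, hb, hb']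
    | @homogeneous j b =>
      rw [A.sgn_of_mem a.2, A.sgn_of_mem b.2,
        A.sgn_of_mem (SetLike.GradedMul.mul_mem a.2 b.2 : (a * b : A) ∈ A.gr (i + j)),
        Int.negOnePow_add, Units.smul_def, Units.smul_def, Units.smul_def, smul_mul_smul_comm,
        Units.val_mul]

@[simp]
theorem d_sgn (a : A) : A.d (A.sgn a) = -A.sgn (A.d a) := by
  induction a using DirectSum.Decomposition.inductionOn A.gr with
  | zero => simp
  | add a b ha hb => simp only [map_add, ha, hb]; abel
  | @homogeneous i m =>
    rw [A.sgn_of_mem m.2, A.sgn_of_mem (A.d_mem i m m.2), Int.negOnePow_succ, Units.smul_def,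
      Units.smul_def, map_zsmul]
    simp

/-- With the sign absorbed into the linear map `sgn`, the Leibniz rule holds for inhomogeneous
elements and can be applied coefficientwise in free modules. -/
theorem leibniz_sgn (a b : A) : A.d (a * b) = A.d a * b + A.sgn a * A.d b := by
  induction a using DirectSum.Decomposition.inductionOn A.gr with
  | zero => simp
  | add a a' ha ha' => simp only [add_mul, map_add, ha, ha']; abel
  | @homogeneous i m =>
    rw [A.leibniz i m b m.2, A.sgn_of_mem m.2, Units.smul_def, Units.smul_def, smul_mul_assoc]

theorem d_algebraMap (c : k) : A.d (algebraMap k A c) = 0 := by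
  rw [Algebra.algebraMap_eq_smul_one, map_smul, A.d_one, smul_zero]

theorem IsConnected.augmentation_sgn {A : DGAlgebra k} (hA : A.IsConnected) (a : A) :
    hA.augmentation (A.sgn a) = hA.augmentation a := by
  induction a using DirectSum.Decomposition.inductionOn A.gr with
  | zero => simp
  | add a b ha hb => simp [ha, hb]
  | @homogeneous i m =>
    rcases eq_or_ne i 0 with rfl | hi
    · rw [A.sgn_of_mem m.2]
      simp
    · rw [hA.augmentation_of_mem i _ (A.sgn_mem m.2) hi, hA.augmentation_of_mem i _ m.2 hi]

/-- The differential on coefficients. -/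
noncomputable def mapD (X : Type*) : (X →₀ A) →ₗ[k] X →₀ A := Finsupp.mapRange.linearMap A.d

/-- The sign involution on coefficients. -/
noncomputable def mapS (X : Type*) : (X →₀ A) →ₗ[k] X →₀ A := Finsupp.mapRange.linearMap A.sgn

variable {X : Type*}

@[simp]
theorem mapD_apply (f : X →₀ A) (x : X) : A.mapD X f x = A.d (f x) := rfl

@[simp]
theorem mapS_apply (f : X →₀ A) (x : X) : A.mapS X f x = A.sgn (f x) := rfl

@[simp]
theorem mapD_single (x : X) (a : A) :
    A.mapD X (Finsupp.single x a) = Finsupp.single x (A.d a) := by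
  simp [mapD]

@[simp]
theorem mapS_single (x : X) (a : A) :
    A.mapS X (Finsupp.single x a) = Finsupp.single x (A.sgn a) := by
  simp [mapS]

theorem mapD_mapD (f : X →₀ A) : A.mapD X (A.mapD X f) = 0 := by
  ext x
  simp [A.d_d]

theorem mapS_mapS (f : X →₀ A) : A.mapS X (A.mapS X f) = f := by
  ext x
  simp

theorem mapD_mapS (f : X →₀ A) : A.mapD X (A.mapS X f) = -A.mapS X (A.mapD X f) := by
  ext x
  simp

theorem mapD_smul (a : A) (f : X →₀ A) :
    A.mapD X (a • f) = A.d a • f + A.sgn a • A.mapD X f := by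
  ext x
  simp [A.leibniz_sgn]

theorem mapS_smul (a : A) (f : X →₀ A) : A.mapS X (a • f) = A.sgn a • A.mapS X f := by
  ext x
  simp [A.sgn_mul]

theorem mapD_extendScalars (c : X →₀ k) : A.mapD X (extendScalars A c) = 0 := by
  ext x
  simp [A.d_algebraMap]

theorem exists_mapD_eq {c : X →₀ A} (h : ∀ x, ∃ y, A.d y = c x) : ∃ y, A.mapD X y = c := by
  change c ∈ LinearMap.range (A.mapD X)
  rw [← c.sum_single]
  refine sum_mem fun x _ => ?_
  obtain ⟨y, hy⟩ := h x
  exact ⟨Finsupp.single x y, by simp [hy]⟩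

theorem mapD_linearCombination {Y : Type*} (rel : Y → X →₀ A) (hrel : ∀ y, A.mapD X (rel y) = 0)
    (c : Y →₀ A) : A.mapD X (Finsupp.linearCombination A rel c) =
      Finsupp.linearCombination A rel (A.mapD Y c) := by
  induction c using Finsupp.induction_linear with
  | zero => simp
  | add f g hf hg => simp only [map_add, hf, hg]
  | single y a => simp [mapD_smul, hrel]

theorem linearCombination_mapS_smul {Y M : Type*} [AddCommGroup M] [Module A M] (m : Y → M)
    (a : A) (c : Y →₀ A) : Finsupp.linearCombination A m (A.mapS Y (a • c)) =
      A.sgn a • Finsupp.linearCombination A m (A.mapS Y c) := by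
  rw [mapS_smul, map_smul]

theorem mapD_mem_freeGrading (deg : X → ℤ) {i : ℤ} {f : X →₀ A}
    (hf : f ∈ freeGrading A.gr deg i) : A.mapD X f ∈ freeGrading A.gr deg (i + 1) := fun x => by
  rw [add_sub_right_comm]
  exact A.d_mem _ _ (hf x)

theorem mapS_mem_freeGrading (deg : X → ℤ) {i : ℤ} {f : X →₀ A}
    (hf : f ∈ freeGrading A.gr deg i) : A.mapS X f ∈ freeGrading A.gr deg i :=
  fun x => A.sgn_mem (hf x)

end DGAlgebra

/-! ### Generalities on DG modules -/

namespace DGModule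

variable {k : Type u} [Field k] {A : DGAlgebra k}

theorem leibniz_sgn (M : DGModule A) (a : A) (m : M) :
    M.d (a • m) = A.d a • m + A.sgn a • M.d m := by
  induction a using DirectSum.Decomposition.inductionOn A.gr with
  | zero => simp
  | add a a' ha ha' => simp only [add_smul, map_add, ha, ha']; abel
  | @homogeneous i a =>
    rw [M.leibniz i a m a.2, A.sgn_of_mem a.2, Units.smul_def, Units.smul_def, smul_assoc]

theorem d_linearCombination (M : DGModule A) {X : Type*} (m : X → M) (c : X →₀ A) :
    M.d (Finsupp.linearCombination A m c) = Finsupp.linearCombination A m (A.mapD X c) +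
      Finsupp.linearCombination A (fun x => M.d (m x)) (A.mapS X c) := by
  induction c using Finsupp.induction_linear with
  | zero => simp
  | add f g hf hg => simp only [map_add, hf, hg]; abel
  | single x a => simp [leibniz_sgn]

theorem linearCombination_mem_gr (M : DGModule A) {X : Type*} {deg : X → ℤ} {m : X → M}
    (hm : ∀ x, m x ∈ M.gr (deg x)) {i : ℤ} {c : X →₀ A} (hc : c ∈ freeGrading A.gr deg i) :
    Finsupp.linearCombination A m c ∈ M.gr i := by
  rw [Finsupp.linearCombination_apply]
  refine sum_mem fun x _ => ?_
  have := M.smul_mem _ _ _ _ (hc x) (hm x)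
  rwa [sub_add_cancel] at this

theorem gradedProj_d (M : DGModule A) (i : ℤ) (x : M) :
    gradedProj M.gr (i + 1) (M.d x) = M.d (gradedProj M.gr i x) := by
  induction x using DirectSum.Decomposition.inductionOn M.gr with
  | zero => simp
  | add a b ha hb => simp only [map_add, ha, hb]
  | @homogeneous j m =>
    by_cases h : j = i
    · subst h
      rw [gradedProj_of_mem _ (M.d_mem _ _ m.2), gradedProj_of_mem _ m.2]
    · rw [gradedProj_of_mem_ne _ (M.d_mem _ _ m.2) (by omega), gradedProj_of_mem_ne _ m.2 h,
        map_zero]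

theorem mk_eq_mk_iff (M : DGModule A) (z w : LinearMap.ker M.d) :
    (Submodule.Quotient.mk z : M.Cohomology) = Submodule.Quotient.mk w ↔
      ∃ x, M.d x = (z : M) - w := by
  rw [Submodule.Quotient.eq]
  rfl

/-- Injectivity and surjectivity on cohomology, unfolded to arbitrary, possibly inhomogeneous,
cocycles. -/
theorem Hom.isQuasiIso_iff {M N : DGModule A} (f : Hom M N) :
    f.IsQuasiIso ↔ (∀ v, M.d v = 0 → (∃ x, N.d x = f.toLinearMap v) → ∃ y, M.d y = v) ∧
      ∀ w, N.d w = 0 → ∃ v, M.d v = 0 ∧ ∃ x, N.d x = f.toLinearMap v - w := by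
  refine and_congr ?_ ?_
  · rw [injective_iff_map_eq_zero]
    constructor
    · intro h v hv hx
      have h1 := h (Submodule.Quotient.mk ⟨v, hv⟩) ((N.mk_eq_mk_iff _ 0).2 (by simpa using! hx))
      obtain ⟨y, hy⟩ := (M.mk_eq_mk_iff _ 0).1 h1
      exact ⟨y, by simpa using hy⟩
    · intro h a ha
      obtain ⟨⟨v, hv⟩, rfl⟩ := Submodule.Quotient.mk_surjective _ a
      obtain ⟨x, hx⟩ := (N.mk_eq_mk_iff _ 0).1 ha
      obtain ⟨y, hy⟩ := h v hv ⟨x, by simpa using! hx⟩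
      exact (M.mk_eq_mk_iff _ 0).2 ⟨y, by simpa using hy⟩
  · constructor
    · intro h w hw
      obtain ⟨a, ha⟩ := h (Submodule.Quotient.mk ⟨w, hw⟩)
      obtain ⟨⟨v, hv⟩, rfl⟩ := Submodule.Quotient.mk_surjective _ a
      exact ⟨v, hv, (N.mk_eq_mk_iff _ _).1 ha⟩
    · intro h a
      obtain ⟨⟨w, hw⟩, rfl⟩ := Submodule.Quotient.mk_surjective _ a
      obtain ⟨v, hv, hx⟩ := h w hw
      exact ⟨Submodule.Quotient.mk ⟨v, hv⟩, (N.mk_eq_mk_iff _ _).2 hx⟩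

/-- The cohomology has a basis of classes of homogeneous cocycles. -/
theorem exists_cocycle_basis (M : DGModule A) : ∃ (B : Type u) (deg : B → ℤ) (z : B → M),
    (∀ b, z b ∈ M.gr (deg b)) ∧ (∀ b, M.d (z b) = 0) ∧
    (∀ w, M.d w = 0 → ∃ c x, w = Finsupp.linearCombination k z c + M.d x) ∧
    ∀ c x, Finsupp.linearCombination k z c = M.d x → c = 0 := by
  classical
  obtain ⟨B, hBs, hspan, hli⟩ := exists_linearIndependent k
    {a : M.Cohomology | ∃ (i : ℤ) (z : LinearMap.ker M.d), (z : M) ∈ M.gr i ∧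
      Submodule.Quotient.mk z = a}
  choose deg z hdeg hz using fun b : B => hBs b.2
  have hcomb : ∀ c : B →₀ k,
      (Submodule.Quotient.mk (Finsupp.linearCombination k z c) : M.Cohomology) =
        Finsupp.linearCombination k ((↑) : B → M.Cohomology) c := fun c => by
    have h := Finsupp.apply_linearCombination k
      (Submodule.mkQ ((LinearMap.range M.d).comap (LinearMap.ker M.d).subtype)) z c
    exact h.trans (by congr 2; exact funext hz)
  have hcoe : ∀ c : B →₀ k, ((Finsupp.linearCombination k z c : LinearMap.ker M.d) : M) =
      Finsupp.linearCombination k (fun b => (z b : M)) c := fun c =>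
    Finsupp.apply_linearCombination k (LinearMap.ker M.d).subtype z c
  refine ⟨B, deg, fun b => z b, hdeg, fun b => (z b).2, ?_, ?_⟩
  · intro w hw
    have htop : ∀ a : M.Cohomology, a ∈ Submodule.span k (B : Set M.Cohomology) := by
      intro a
      obtain ⟨⟨w, hw⟩, rfl⟩ := Submodule.Quotient.mk_surjective _ a
      rw [hspan]
      -- Components of a cocycle are cocycles, so classes of homogeneous cocycles span.
      let p (i : ℤ) : LinearMap.ker M.d := ⟨gradedProj M.gr i w, by
        rw [LinearMap.mem_ker, ← gradedProj_d, LinearMap.mem_ker.1 hw, map_zero]⟩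
      have e : (⟨w, hw⟩ : LinearMap.ker M.d) = ∑ i ∈ (decompose M.gr w).support, p i := by
        apply Subtype.ext
        rw [AddSubmonoidClass.coe_finsetSum]
        exact (DirectSum.sum_support_decompose M.gr w).symm
      rw [e, ← Submodule.mkQ_apply, map_sum]
      exact sum_mem fun i _ => Submodule.subset_span ⟨i, p i, gradedProj_mem _ i w, rfl⟩
    have h1 := htop (Submodule.Quotient.mk ⟨w, hw⟩)
    rw [← Subtype.range_coe (s := B), ← Finsupp.range_linearCombination] at h1
    obtain ⟨c, hc⟩ := h1
    rw [← hcomb] at hc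
    obtain ⟨x, hx⟩ := (M.mk_eq_mk_iff _ _).1 hc
    refine ⟨c, -x, ?_⟩
    rw [map_neg, hx, hcoe]
    simp
  · intro c x hx
    refine linearIndependent_iff.1 hli c ?_
    rw [← hcomb]
    refine (M.mk_eq_mk_iff _ 0).2 ⟨x, ?_⟩
    rw [hcoe, hx]
    simp

end DGModule

/-! ### DG modules with a two-step semi-free filtration -/

namespace DGModule

variable {k : Type u} [Field k] {A : DGAlgebra k}

section TwoStep

variable {X Y : Type u} (degX : X → ℤ) (degY : Y → ℤ) (rel : Y → X →₀ A)
  (hrel : ∀ y, rel y ∈ freeGrading A.gr degX (degY y + 1)) (hd : ∀ y, A.mapD X (rel y) = 0)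

/-- The grading of a two-step semi-free DG module. -/
noncomputable def twoStepGrading (A : DGAlgebra k) {X Y : Type u} (degX : X → ℤ) (degY : Y → ℤ) (i : ℤ) :
    Submodule k ((X →₀ A) × (Y →₀ A)) :=
  (freeGrading A.gr degX i).prod (freeGrading A.gr degY i)

noncomputable instance twoStepDecomposition :
    DirectSum.Decomposition (twoStepGrading A degX degY) :=
  decompositionOfProj _
    (fun i => (freeProj A.gr degX i).prodMap (freeProj A.gr degY i))
    (fun i f hf => by
      refine Prod.ext (Finsupp.ext fun x => ?_) (Finsupp.ext fun y => ?_)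
      · exact (freeProj_apply A.gr degX i f.1 x).trans (gradedProj_of_mem A.gr (hf.1 x))
      · exact (freeProj_apply A.gr degY i f.2 y).trans (gradedProj_of_mem A.gr (hf.2 y)))
    (fun i j hij f hf => by
      refine Prod.ext (Finsupp.ext fun x => ?_) (Finsupp.ext fun y => ?_)
      · exact (freeProj_apply A.gr degX j f.1 x).trans
          (gradedProj_of_mem_ne A.gr (hf.1 x) (by omega))
      · exact (freeProj_apply A.gr degY j f.2 y).trans
          (gradedProj_of_mem_ne A.gr (hf.2 y) (by omega)))
    (fun f => by
      have top (Z : Type u) (deg : Z → ℤ) (g : Z →₀ A) : g ∈ ⨆ i, freeGrading A.gr deg i := by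
        exact mem_of_gradedProj_mem (freeGrading A.gr deg) _ fun i =>
          Submodule.mem_iSup_of_mem i (gradedProj_mem _ i g)
      have h1 : ⨆ i, freeGrading A.gr degX i ≤
          (⨆ i, twoStepGrading A degX degY i).comap (LinearMap.inl k _ _) :=
        iSup_le fun i x hx => Submodule.mem_iSup_of_mem (p := twoStepGrading A degX degY) i
          ⟨hx, zero_mem _⟩
      have h2 : ⨆ i, freeGrading A.gr degY i ≤
          (⨆ i, twoStepGrading A degX degY i).comap (LinearMap.inr k _ _) :=
        iSup_le fun i x hx => Submodule.mem_iSup_of_mem (p := twoStepGrading A degX degY) i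
          ⟨zero_mem _, hx⟩
      have h3 := h1 (top X degX f.1)
      have h4 := h2 (top Y degY f.2)
      rw [Submodule.mem_comap, LinearMap.inl_apply] at h3
      rw [Submodule.mem_comap, LinearMap.inr_apply] at h4
      simpa using add_mem h3 h4)

/-- The differential of a two-step semi-free DG module. -/
noncomputable def twoStepD : (X →₀ A) × (Y →₀ A) →ₗ[k] (X →₀ A) × (Y →₀ A) :=
  LinearMap.prod
    (A.mapD X ∘ₗ LinearMap.fst k _ _ +
      (Finsupp.linearCombination A rel).restrictScalars k ∘ₗ A.mapS Y ∘ₗ LinearMap.snd k _ _)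
    (A.mapD Y ∘ₗ LinearMap.snd k _ _)

/-- The sign involution on the `Y`-coefficients is forced by `d (a y) = d a • y + (-1)^|a| a • rel
y`. -/
theorem twoStepD_apply (f : (X →₀ A) × (Y →₀ A)) :
    twoStepD rel f =
      (A.mapD X f.1 + Finsupp.linearCombination A rel (A.mapS Y f.2), A.mapD Y f.2) := rfl

theorem linearCombination_mem_freeGrading {i : ℤ} {q : Y →₀ A}
    (hrel : ∀ y, rel y ∈ freeGrading A.gr degX (degY y + 1))
    (hq : q ∈ freeGrading A.gr degY i) :
    Finsupp.linearCombination A rel q ∈ freeGrading A.gr degX (i + 1) := by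
  rw [Finsupp.linearCombination_apply]
  refine sum_mem fun y _ => ?_
  have := smul_mem_freeGrading A.gr degX _ _ _ _ (hq y) (hrel y)
  rwa [show i - degY y + (degY y + 1) = i + 1 by ring] at this

/-- The semi-free DG module with basis `X ⊔ Y`, where `d x = 0` and `d y = rel y`. -/
@[reducible]
noncomputable def twoStep : DGModule A where
  carrier := (X →₀ A) × (Y →₀ A)
  gr := twoStepGrading A degX degY
  decomposition := twoStepDecomposition degX degY
  smul_mem i j a m ha hm := ⟨smul_mem_freeGrading A.gr degX i j a m.1 ha hm.1,
    smul_mem_freeGrading A.gr degY i j a m.2 ha hm.2⟩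
  d := twoStepD rel
  d_mem i m hm := ⟨add_mem (A.mapD_mem_freeGrading degX hm.1)
    (linearCombination_mem_freeGrading degX degY rel hrel (A.mapS_mem_freeGrading degY hm.2)),
    A.mapD_mem_freeGrading degY hm.2⟩
  d_d m := by
    simp only [twoStepD_apply, map_add, A.mapD_mapD, zero_add, A.mapD_linearCombination rel hd,
      A.mapD_mapS, map_neg, neg_add_cancel, Prod.mk_zero_zero]
  leibniz i a m ha := by
    have h : ∀ x : (X →₀ A) × (Y →₀ A), i.negOnePow • (a • x) = A.sgn a • x := fun x => by
      rw [A.sgn_of_mem ha, Units.smul_def, Units.smul_def, smul_assoc]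
    rw [h]
    simp only [twoStepD_apply]
    refine Prod.ext ?_ ?_
    · simp only [Prod.smul_fst, Prod.smul_snd, Prod.fst_add, A.mapD_smul,
        A.linearCombination_mapS_smul, smul_add, add_assoc]
    · simp only [Prod.smul_snd, Prod.snd_add, A.mapD_smul]

/-- The filtration steps of `twoStep`. -/
noncomputable def twoStepFil (A : DGAlgebra k) (X Y : Type u) : ℕ → Submodule A ((X →₀ A) × (Y →₀ A))
  | 0 => Submodule.prod ⊤ ⊥
  | _ + 1 => ⊤

theorem linearCombination_single_inl (l : X →₀ A) :
    Finsupp.linearCombination A (fun x => ((Finsupp.single x 1, 0) : (X →₀ A) × (Y →₀ A))) l =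
      (l, 0) := by
  induction l using Finsupp.induction_linear with
  | zero => exact map_zero _
  | add f g hf hg => rw [map_add, hf, hg]; simp
  | single x a => simp

theorem linearCombination_single_inr (l : Y →₀ A) :
    Finsupp.linearCombination A (fun x => ((0, Finsupp.single x 1) : (X →₀ A) × (Y →₀ A))) l =
      (0, l) := by
  induction l using Finsupp.induction_linear with
  | zero => exact map_zero _
  | add f g hf hg => rw [map_add, hf, hg]; simp
  | single x a => simp

/-- The semi-free filtration of `twoStep`. -/
noncomputable def twoStepFiltration : (twoStep degX degY rel hrel hd).SemiFreeFiltration where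
  fil := twoStepFil A X Y
  isDGSubmodule n := by
    cases n with
    | zero =>
      refine ⟨fun i x hx => ?_, fun x hx => ?_⟩
      · let := freeDecomposition (X := Y) A.gr degY
        have h := map_gradedProj (twoStepGrading A degX degY) (freeGrading A.gr degY)
          (LinearMap.snd k _ _) (fun i x hx => hx.2) i x
        refine ⟨trivial, h.trans ?_⟩
        rw [LinearMap.snd_apply, show x.2 = 0 from hx.2, map_zero]
      · refine ⟨trivial, ?_⟩
        change A.mapD Y x.2 = 0
        rw [show x.2 = 0 from hx.2, map_zero]
    | succ n => exact ⟨fun _ _ _ => trivial, fun _ _ => trivial⟩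
  mono := monotone_nat_of_le_succ fun n => le_top
  exhaustive := eq_top_iff.2 (le_iSup (twoStepFil A X Y) 1)
  zero_free := by
    refine ⟨X, fun x => (Finsupp.single x 1, 0), fun x => ⟨⟨trivial, rfl⟩, ⟨degX x,
      single_one_mem_freeGrading A.gr degX x, zero_mem _⟩, ?_⟩, ?_, ?_⟩
    · change twoStepD rel _ = 0
      simp [twoStepD_apply, A.d_one]
    · rw [linearIndependent_iff]
      intro l hl
      have h := Finsupp.apply_linearCombination A
        (Submodule.mkQ (⊥ : Submodule A ((X →₀ A) × (Y →₀ A))))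
        (fun x => ((Finsupp.single x 1, 0) : (X →₀ A) × (Y →₀ A))) l
      have h1 := h.trans hl
      rw [linearCombination_single_inl] at h1
      have h2 := (Submodule.Quotient.mk_eq_zero _).1 h1
      exact (Prod.mk.inj ((Submodule.mem_bot A).1 h2)).1
    · have h : Submodule.span A (Set.range
          (fun x => ((Finsupp.single x 1, 0) : (X →₀ A) × (Y →₀ A)))) = twoStepFil A X Y 0 := by
        rw [← Finsupp.range_linearCombination]
        ext x
        constructor
        · rintro ⟨l, rfl⟩
          rw [linearCombination_single_inl]
          exact ⟨trivial, rfl⟩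
        · intro hx
          refine ⟨x.1, ?_⟩
          rw [linearCombination_single_inl]
          exact Prod.ext rfl hx.2.symm
      rw [← h, Submodule.map_span, ← Set.range_comp]
      rfl
  succ_free n := by
    cases n with
    | zero =>
      have hq (l : Y →₀ A) : Finsupp.linearCombination A (fun y => (twoStepFil A X Y 0).mkQ
          (0, Finsupp.single y 1)) l = (twoStepFil A X Y 0).mkQ (0, l) := by
        rw [← linearCombination_single_inr (X := X) l, Finsupp.apply_linearCombination]
        rfl
      refine ⟨Y, fun y => (0, Finsupp.single y 1), fun y => ⟨trivial, ⟨degY y,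
        zero_mem _, single_one_mem_freeGrading A.gr degY y⟩, trivial, ?_⟩, ?_, ?_⟩
      · change A.mapD Y (Finsupp.single y 1) = 0
        simp [A.d_one]
      · rw [linearIndependent_iff]
        intro l hl
        have h2 := (Submodule.Quotient.mk_eq_zero _).1 ((hq l).symm.trans hl)
        exact h2.2
      · rw [← Finsupp.range_linearCombination]
        apply le_antisymm
        · rintro _ ⟨l, rfl⟩
          exact ⟨(0, l), trivial, (hq l).symm⟩
        · rintro _ ⟨x, -, rfl⟩
          refine ⟨x.2, (hq x.2).trans ?_⟩
          refine (Submodule.Quotient.eq _).2 ⟨trivial, ?_⟩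
          change x.2 - x.2 = 0
          exact sub_self _
    | succ n =>
      refine ⟨PEmpty, fun y => y.elim, fun y => y.elim, linearIndependent_empty_type, ?_⟩
      rw [Set.range_eq_empty, Submodule.span_empty]
      refine (eq_bot_iff.2 ?_).symm
      rintro _ ⟨x, -, rfl⟩
      exact (Submodule.Quotient.mk_eq_zero _).2 trivial

theorem twoStep_isSemiFree : (twoStep degX degY rel hrel hd).IsSemiFree :=
  ⟨twoStepFiltration degX degY rel hrel hd⟩

/-- The only obstruction to strictness is `F(0) = 0` with `F ≠ 0`. If `X` is nonempty, then `F(0) =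
0` forces `1 = 0` in `A`, hence `F = 0`; if `X` is empty, then `hXY` gives `F = 0`. -/
theorem twoStepFiltration_isStrictlyIncreasing (hXY : IsEmpty X → IsEmpty Y) :
    (twoStepFiltration degX degY rel hrel hd).IsStrictlyIncreasing := by
  rintro (_ | _ | n) h1 h2
  · have hb : ∀ p : X →₀ A, p = 0 := fun p => by
      have h3 : ((p, 0) : (X →₀ A) × (Y →₀ A)) ∈ twoStepFil A X Y 0 := ⟨trivial, rfl⟩
      have h4 : ((p, 0) : (X →₀ A) × (Y →₀ A)) ∈ (⊥ : Submodule A ((X →₀ A) × (Y →₀ A))) :=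
        (Eq.symm h2 : twoStepFil A X Y 0 = ⊥) ▸ h3
      exact (Prod.mk.inj ((Submodule.mem_bot A).1 h4)).1
    apply h1
    refine eq_top_iff.2 fun x _ => ?_
    change x = 0
    rcases isEmpty_or_nonempty X with hX | ⟨⟨x₀⟩⟩
    · have := hXY hX
      exact Prod.ext (Subsingleton.elim _ _) (Subsingleton.elim _ _)
    · have h5 : (1 : A) = 0 := Finsupp.single_eq_zero.1 (hb (Finsupp.single x₀ 1))
      rw [← one_smul A x, h5, zero_smul]
  · exact h1 h2
  · exact h1 rfl

/-- The length is 0 or 1 according to whether `F(0)` is already everything. -/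
theorem dgFreeClass_twoStep_le_one (hXY : IsEmpty X → IsEmpty Y) :
    (twoStep degX degY rel hrel hd).dgFreeClass ≤ 1 := by
  by_cases h : (twoStepFiltration degX degY rel hrel hd).fil 0 = ⊤
  · refine le_trans (iInf₂_le 0 ⟨_,
      twoStepFiltration_isStrictlyIncreasing degX degY rel hrel hd hXY, h, ?_⟩) zero_le_one
    exact fun m hm => absurd hm (by omega)
  · refine iInf₂_le 1 ⟨_,
      twoStepFiltration_isStrictlyIncreasing degX degY rel hrel hd hXY, rfl, ?_⟩
    intro m hm
    obtain rfl : m = 0 := by omega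
    exact h

theorem dgFreeClass_twoStep_eq_zero [IsEmpty Y] :
    (twoStep degX degY rel hrel hd).dgFreeClass = 0 := by
  refine nonpos_iff_eq_zero.1 (iInf₂_le 0 ⟨twoStepFiltration degX degY rel hrel hd,
    twoStepFiltration_isStrictlyIncreasing degX degY rel hrel hd fun _ => inferInstance, ?_, ?_⟩)
  · exact eq_top_iff.2 fun x _ => ⟨trivial, Subsingleton.elim _ _⟩
  · exact fun m hm => absurd hm (by omega)

/-- The morphism from `twoStep` given by the images of the basis elements. -/
noncomputable def twoStepLift {M : DGModule A} (m₀ : X → M) (m₁ : Y → M)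
    (h₀ : ∀ x, m₀ x ∈ M.gr (degX x)) (h₁ : ∀ y, m₁ y ∈ M.gr (degY y))
    (hd₀ : ∀ x, M.d (m₀ x) = 0)
    (hd₁ : ∀ y, M.d (m₁ y) = Finsupp.linearCombination A m₀ (rel y)) :
    Hom (twoStep degX degY rel hrel hd) M where
  toLinearMap := LinearMap.coprod (Finsupp.linearCombination A m₀) (Finsupp.linearCombination A m₁)
  map_mem i f hf := add_mem (M.linearCombination_mem_gr h₀ hf.1) (M.linearCombination_mem_gr h₁ hf.2)
  comm f := by
    change M.d (Finsupp.linearCombination A m₀ f.1 + Finsupp.linearCombination A m₁ f.2) =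
      Finsupp.linearCombination A m₀ (A.mapD X f.1 +
        Finsupp.linearCombination A rel (A.mapS Y f.2)) +
      Finsupp.linearCombination A m₁ (A.mapD Y f.2)
    have e : (fun y => M.d (m₁ y)) = Finsupp.linearCombination A m₀ ∘ rel := funext hd₁
    have e' : Finsupp.linearCombination A (fun x => M.d (m₀ x)) (A.mapS X f.1) = 0 := by
      rw [show (fun x => M.d (m₀ x)) = fun _ => 0 from funext hd₀]
      simp [Finsupp.linearCombination_apply]
    rw [map_add, d_linearCombination, d_linearCombination, e', e, map_add,
      Finsupp.apply_linearCombination]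
    abel

end TwoStep

end DGModule

/-! ### Exactness of the standard resolution on the level of cocycles -/

section MapCoeff

variable {k R S X T B : Type*} [Field k] [Ring R] [Algebra k R] [Ring S] [Algebra k S]

/-- Change of coefficients in a free module. -/
noncomputable def mapCoeff (X : Type*) (φ : R →ₐ[k] S) : (X →₀ R) →ₗ[k] X →₀ S :=
  Finsupp.mapRange.linearMap φ.toLinearMap

@[simp]
theorem mapCoeff_apply (φ : R →ₐ[k] S) (f : X →₀ R) (x : X) : mapCoeff X φ f x = φ (f x) := rfl

@[simp]
theorem mapCoeff_single (φ : R →ₐ[k] S) (x : X) (r : R) :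
    mapCoeff X φ (Finsupp.single x r) = Finsupp.single x (φ r) := by
  simp [mapCoeff]

theorem mapCoeff_extendScalars (φ : R →ₐ[k] S) (c : X →₀ k) :
    mapCoeff X φ (extendScalars R c) = extendScalars S c := by
  ext x
  simp

theorem mapCoeff_linearCombination {Y : Type*} (φ : R →ₐ[k] S) (m : Y → X →₀ R) (y : Y →₀ R) :
    mapCoeff X φ (Finsupp.linearCombination R m y) =
      Finsupp.linearCombination S (fun i => mapCoeff X φ (m i)) (mapCoeff Y φ y) := by
  induction y using Finsupp.induction_linear with
  | zero => simp
  | add f g hf hg => simp only [map_add, hf, hg]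
  | single i r =>
    simp only [Finsupp.linearCombination_single, mapCoeff_single]
    ext x
    simp

theorem map_linearCombination {Y : Type*} (φ : R →ₐ[k] S) (m : Y → R) (y : Y →₀ R) :
    φ (Finsupp.linearCombination R m y) =
      Finsupp.linearCombination S (fun i => φ (m i)) (mapCoeff Y φ y) := by
  induction y using Finsupp.induction_linear with
  | zero => simp
  | add f g hf hg => simp only [map_add, hf, hg]
  | single i r => simp

/-- Naturality in the coefficients, used along both maps out of the algebra of cocycles: the
inclusion into `A` and the projection onto `H(A)`. -/
theorem mapCoeff_standardMap (φ : R →ₐ[k] S) (v : T → R) (ρ : T → B → B →₀ k) (y : T × B →₀ R) :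
    mapCoeff B φ (standardMap v ρ y) = standardMap (fun t => φ (v t)) ρ (mapCoeff _ φ y) := by
  rw [standardMap, mapCoeff_linearCombination, standardMap]
  congr 2
  funext tb
  rw [standardRelation, map_sub, mapCoeff_single, mapCoeff_extendScalars, standardRelation]

end MapCoeff

namespace DGAlgebra

variable {k : Type u} [Field k] (A : DGAlgebra k) {X T B : Type*}

/-- The class of a cocycle. -/
abbrev toCohomology : A.cocycles →ₐ[k] A.Cohomology := Ideal.Quotient.mkₐ k A.coboundaries

theorem toCohomology_eq_zero_iff {z : A.cocycles} :
    A.toCohomology z = 0 ↔ ∃ x, A.d x = z := Ideal.Quotient.eq_zero_iff_mem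

theorem exists_mapCoeff_val_eq {c : X →₀ A} (hc : A.mapD X c = 0) :
    ∃ c' : X →₀ A.cocycles, mapCoeff X A.cocycles.val c' = c := by
  change c ∈ LinearMap.range (mapCoeff X A.cocycles.val)
  rw [← c.sum_single]
  refine sum_mem fun x _ => ⟨Finsupp.single x ⟨c x, ?_⟩, by simp⟩
  exact DFunLike.congr_fun hc x

theorem mapD_mapCoeff_val (c : X →₀ A.cocycles) :
    A.mapD X (mapCoeff X A.cocycles.val c) = 0 := by
  ext x
  exact (c x).2

theorem mapCoeff_toCohomology_eq_zero_iff {c : X →₀ A.cocycles} :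
    mapCoeff X A.toCohomology c = 0 ↔ ∃ y, A.mapD X y = mapCoeff X A.cocycles.val c := by
  constructor
  · intro h
    exact A.exists_mapD_eq fun x => A.toCohomology_eq_zero_iff.1 (DFunLike.congr_fun h x)
  · rintro ⟨y, hy⟩
    ext x
    exact A.toCohomology_eq_zero_iff.2 ⟨y x, DFunLike.congr_fun hy x⟩

theorem mapCoeff_toCohomology_surjective :
    Function.Surjective (mapCoeff X A.toCohomology) := by
  intro c
  change c ∈ LinearMap.range (mapCoeff X A.toCohomology)
  rw [← c.sum_single]
  refine sum_mem fun x _ => ?_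
  obtain ⟨z, hz⟩ := Ideal.Quotient.mk_surjective (c x)
  exact ⟨Finsupp.single x z, by rw [mapCoeff_single]; exact congrArg _ hz⟩

theorem exists_homogeneous_cocycles {deg : T → ℤ} {v : T → A.Cohomology}
    (hv : ∀ t, v t ∈ A.cohomologyGr (deg t)) : ∃ z : T → A.cocycles,
      (∀ t, (z t : A) ∈ A.gr (deg t)) ∧ ∀ t, A.toCohomology (z t) = v t := by
  choose z hdeg hz using hv
  exact ⟨z, hdeg, hz⟩

variable {A} {v : T → A.Cohomology} {z : T → A.cocycles} (hz : ∀ t, A.toCohomology (z t) = v t)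
  (ρ : T → B → B →₀ k)

include hz

/-- The coefficients of `c` are cocycles whose classes are killed by the injective standard map over
`H(A)`. So these classes vanish. -/
theorem exists_mapD_eq_of_standardMap (hinj : Function.Injective (standardMap v ρ))
    {c : T × B →₀ A} (hc : A.mapD _ c = 0) {x : B →₀ A}
    (hx : standardMap (fun t => (z t : A)) ρ c = A.mapD _ x) : ∃ y, A.mapD _ y = c := by
  obtain ⟨c, rfl⟩ := A.exists_mapCoeff_val_eq hc
  rw [← A.mapCoeff_toCohomology_eq_zero_iff]
  apply hinj
  have h : standardMap (fun t => (z t : A)) ρ (mapCoeff _ A.cocycles.val c) =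
      mapCoeff B A.cocycles.val (standardMap z ρ c) := 
    (mapCoeff_standardMap A.cocycles.val z ρ c).symm
  rw [h] at hx
  have h2 := A.mapCoeff_toCohomology_eq_zero_iff.2 ⟨x, hx.symm⟩
  rw [mapCoeff_standardMap] at h2
  rw [map_zero, ← h2]
  congr 2
  exact funext fun t => (hz t).symm

/-- Lift the decomposition of the class of `p` over `H(A)` to cocycles; equality of classes becomes
equality up to a coboundary. -/
theorem exists_standardMap_add_mapD
    (hsurj : ∀ x : B →₀ A.Cohomology, ∃ (y : T × B →₀ A.Cohomology) (n : B →₀ k),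
      x = standardMap v ρ y + extendScalars A.Cohomology n)
    {p : B →₀ A} (hp : A.mapD _ p = 0) : ∃ (c : T × B →₀ A) (n : B →₀ k) (x : B →₀ A),
      A.mapD _ c = 0 ∧
      p = standardMap (fun t => (z t : A)) ρ c + extendScalars A n + A.mapD _ x := by
  obtain ⟨p, rfl⟩ := A.exists_mapCoeff_val_eq hp
  obtain ⟨y, n, h⟩ := hsurj (mapCoeff B A.toCohomology p)
  obtain ⟨c, rfl⟩ := A.mapCoeff_toCohomology_surjective y
  have e : standardMap v ρ (mapCoeff _ A.toCohomology c) =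
      mapCoeff B A.toCohomology (standardMap z ρ c) := by
    rw [mapCoeff_standardMap]
    congr 2
    exact funext fun t => (hz t).symm
  rw [e, ← mapCoeff_extendScalars A.toCohomology, ← map_add, ← sub_eq_zero, ← map_sub,
    mapCoeff_toCohomology_eq_zero_iff] at h
  obtain ⟨x, hx⟩ := h
  refine ⟨mapCoeff _ A.cocycles.val c, n, x, A.mapD_mapCoeff_val c, ?_⟩
  rw [hx, map_sub, map_add, mapCoeff_extendScalars, mapCoeff_standardMap]
  exact (add_sub_cancel _ _).symm

end DGAlgebra

/-! ### The standard semi-free resolution -/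

namespace DGModule

variable {k : Type u} [Field k] {A : DGAlgebra k} {T B : Type u}

section StandardModule

variable {deg : T → ℤ} {e : B → ℤ} {z : T → A} {ρ : T → B → B →₀ k}

theorem standardRelation_mem (hz : ∀ t, z t ∈ A.gr (deg t))
    (hρ : ∀ t b b', e b' ≠ deg t + e b → ρ t b b' = 0) (tb : T × B) :
    standardRelation z ρ tb ∈ freeGrading A.gr e (deg tb.1 + e tb.2 - 1 + 1) := by
  obtain ⟨t, b⟩ := tb
  refine sub_mem (single_mem_freeGrading A.gr e (by simpa using hz t)) fun b' => ?_
  rw [extendScalars_apply]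
  by_cases h : e b' = deg t + e b
  · rw [h]
    simpa using DGAlgebra.IsConnected.algebraMap_mem A (ρ t b b')
  · rw [hρ t b b' h, map_zero]
    exact zero_mem _

theorem mapD_standardRelation (hz : ∀ t, A.d (z t) = 0) (tb : T × B) :
    A.mapD B (standardRelation z ρ tb) = 0 := by
  rw [standardRelation, map_sub, A.mapD_single, hz, A.mapD_extendScalars, Finsupp.single_zero,
    sub_zero]

end StandardModule

/-- Realises the standard resolution of `H(M)` by a single semi-free module. Let the cocycles `w b`
represent a basis of `H(M)` and `z t` represent `v t`. In cohomology `z t • w b` is a combination of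
the `w b'` with coefficients `ρ t b`. The generator `(t, b)` has differential `z t ⊗ b - ρ t b` and
is sent to a cochain `x'` bounding the corresponding difference in `M`. The differential raises
degrees by one, whence the `- 1` in the degree of `(t, b)`. -/
theorem exists_standardResolution {hA : A.IsConnected} {deg : T → ℤ} {v : T → A.Cohomology}
    (hv : IsMinimalGenerators A.cohomologyGr hA.cohomologyAugmentation deg v)
    (hli : LinearIndependent A.Cohomology v) (M : DGModule A) :
    ∃ (B : Type u) (e : B → ℤ) (rel : T × B → B →₀ A)
      (hrel : ∀ y, rel y ∈ freeGrading A.gr e (deg y.1 + e y.2 - 1 + 1))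
      (hd : ∀ y, A.mapD B (rel y) = 0)
      (ε : Hom (twoStep e (fun y : T × B => deg y.1 + e y.2 - 1) rel hrel hd) M),
      ε.IsQuasiIso := by
  classical
  obtain ⟨z, hzdeg, hz⟩ := A.exists_homogeneous_cocycles hv.mem
  obtain ⟨B, e, w, hw, hdw, hspan, hind⟩ := M.exists_cocycle_basis
  have hcoc : ∀ t b, M.d ((z t : A) • w b) = 0 := fun t b => by
    rw [M.leibniz_sgn, hdw, show A.d (z t : A) = 0 from (z t).2, zero_smul, smul_zero, add_zero]
  have hzw : ∀ t b, (z t : A) • w b ∈ M.gr (deg t + e b) := fun t b =>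
    M.smul_mem _ _ _ _ (hzdeg t) (hw b)
  choose c x hcx using fun t b => hspan _ (hcoc t b)
  let ρ (t : T) (b : B) : B →₀ k := (c t b).filter fun b' => e b' = deg t + e b
  have hρ : ∀ t b b', e b' ≠ deg t + e b → ρ t b b' = 0 := fun t b b' h =>
    Finsupp.filter_apply_neg _ _ h
  -- Passing to a homogeneous component of the bounding cochain keeps the equation, because both `z
  -- t • w b` and the filtered combination have degree `deg t + e b`.
  let x' (t : T) (b : B) : M := gradedProj M.gr (deg t + e b - 1) (x t b)
  have hx' : ∀ t b, M.d (x' t b) = (z t : A) • w b - Finsupp.linearCombination k w (ρ t b) := by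
    intro t b
    rw [← gradedProj_d, sub_add_cancel, ← gradedProj_linearCombination M.gr e w hw, eq_sub_iff_add_eq',
      ← map_add, ← hcx, gradedProj_of_mem _ (hzw t b)]
  have hdx : ∀ tb : T × B, M.d (x' tb.1 tb.2) =
      Finsupp.linearCombination A w (standardRelation (fun t => (z t : A)) ρ tb) := by
    rintro ⟨t, b⟩
    rw [hx', standardRelation, map_sub, Finsupp.linearCombination_single,
      linearCombination_extendScalars]
  let ε := twoStepLift e (fun y : T × B => deg y.1 + e y.2 - 1) _ (standardRelation_mem hzdeg hρ)
    (mapD_standardRelation fun t => (z t).2) w (fun tb => x' tb.1 tb.2) hw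
    (fun tb => gradedProj_mem _ _ _) hdw hdx
  refine ⟨B, e, standardRelation (fun t => (z t : A)) ρ, standardRelation_mem hzdeg hρ,
    mapD_standardRelation fun t => (z t).2, ε, ?_⟩
  have hε : ∀ n, ε.toLinearMap (extendScalars A n, 0) = Finsupp.linearCombination k w n := by
    intro n
    rw [← linearCombination_extendScalars (R := A)]
    change Finsupp.linearCombination A w (extendScalars A n) +
      Finsupp.linearCombination A (fun tb : T × B => x' tb.1 tb.2) 0 = _
    rw [map_zero, add_zero]
  rw [Hom.isQuasiIso_iff]
  constructor
  · rintro ⟨p, q⟩ hpq ⟨y, hy⟩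
    change twoStepD _ _ = 0 at hpq
    rw [twoStepD_apply, Prod.mk_eq_zero] at hpq
    obtain ⟨hp, hq⟩ := hpq
    dsimp only at hp hq
    -- The cocycle condition says that the standard map sends the sign-twisted `q` to the coboundary
    -- of `-p`. Injectivity over `H(A)` then makes `q` a coboundary, which permits its removal.
    obtain ⟨y₁, hy₁⟩ := DGAlgebra.exists_mapD_eq_of_standardMap hz ρ
      (hv.standardMap_injective hli ρ) (c := A.mapS _ q) (by rw [A.mapD_mapS, hq]; simp)
      (x := -p) (by rw [map_neg, ← add_eq_zero_iff_eq_neg', standardMap]; exact hp)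
    have hp' : A.mapD B (p + standardMap (fun t => (z t : A)) ρ y₁) = 0 := by
      rw [map_add, standardMap, A.mapD_linearCombination _ (mapD_standardRelation fun t => (z t).2),
        hy₁]
      exact hp
    obtain ⟨c₁, n, x₁, hc₁, h₁⟩ := DGAlgebra.exists_standardMap_add_mapD hz ρ
      (hv.exists_standardMap_add hA.isConnectedGraded ρ) hp'
    -- Every cocycle is cohomologous to one with scalar coefficients on `B`.
    have hF : ((p, q) : (B →₀ A) × (T × B →₀ A)) =
        twoStepD (standardRelation (fun t => (z t : A)) ρ) (x₁, A.mapS _ c₁ - A.mapS _ y₁) +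
          (extendScalars A n, 0) := by
      rw [twoStepD_apply]
      refine Prod.ext ?_ ?_
      · simp only [Prod.mk_add_mk, map_sub, A.mapS_mapS]
        rw [← standardMap, ← add_sub_cancel_right p (standardMap (fun t => (z t : A)) ρ y₁), h₁]
        abel
      · simp only [Prod.mk_add_mk, map_sub, A.mapD_mapS, hc₁, hy₁, A.mapS_mapS, map_zero]
        simp
    set f : (B →₀ A) × (T × B →₀ A) := (x₁, A.mapS _ c₁ - A.mapS _ y₁)
    -- The image of `(p, q)` bounds in `M`, hence so does `∑ n_b w_b`; the classes of the `w b` are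
    -- independent.
    have hn : n = 0 := by
      refine hind n (y - ε.toLinearMap f) ?_
      rw [map_sub, hy, ε.comm, ← hε, eq_sub_iff_add_eq, ← map_add, add_comm]
      exact congrArg ε.toLinearMap hF.symm
    refine ⟨f, ?_⟩
    rw [hF, hn, map_zero, Prod.mk_zero_zero, add_zero]
  · intro m hm
    obtain ⟨c₁, x₁, h⟩ := hspan m hm
    refine ⟨(extendScalars A c₁, 0), ?_, -x₁, ?_⟩
    · change twoStepD _ _ = 0
      rw [twoStepD_apply, A.mapD_extendScalars]
      simp
    · rw [hε, h, map_neg]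
      abel

theorem coneLength_le_one {hA : A.IsConnected} {deg : T → ℤ} {v : T → A.Cohomology}
    (hv : IsMinimalGenerators A.cohomologyGr hA.cohomologyAugmentation deg v)
    (hli : LinearIndependent A.Cohomology v) (M : DGModule A) : M.coneLength ≤ 1 := by
  obtain ⟨B, e, rel, hrel, hd, ε, hε⟩ := exists_standardResolution hv hli M
  exact (iInf₂_le _ ⟨twoStep_isSemiFree _ _ _ _ _, ε, hε⟩).trans
    (dgFreeClass_twoStep_le_one _ _ _ _ _ fun h => ⟨fun tb => h.elim tb.2⟩)

theorem coneLength_eq_zero [IsEmpty T] {hA : A.IsConnected} {deg : T → ℤ} {v : T → A.Cohomology}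
    (hv : IsMinimalGenerators A.cohomologyGr hA.cohomologyAugmentation deg v) (M : DGModule A) :
    M.coneLength = 0 := by
  obtain ⟨B, e, rel, hrel, hd, ε, hε⟩ :=
    exists_standardResolution hv linearIndependent_empty_type M
  have h := dgFreeClass_twoStep_eq_zero e (fun y : T × B => deg y.1 + e y.2 - 1) rel hrel hd
  exact nonpos_iff_eq_zero.1
    ((iInf₂_le _ ⟨twoStep_isSemiFree _ _ _ _ _, ε, hε⟩).trans h.le)

end DGModule

/-! ### Semi-free resolutions of the trivial module -/

namespace DGAlgebra

variable {k : Type u} [Field k] {A : DGAlgebra k} {hA : A.IsConnected} {T : Type u} {deg : T → ℤ}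
  {v : T → A.Cohomology} {z : T → A.cocycles}

/-- Minimality at cochain level, for relations that hold up to a coboundary. -/
theorem augmentation_eq_zero_of_linearCombination
    (hv : IsMinimalGenerators A.cohomologyGr hA.cohomologyAugmentation deg v)
    (hz : ∀ t, A.toCohomology (z t) = v t) {c : T →₀ A} (hc : A.mapD T c = 0) {x : A}
    (hx : Finsupp.linearCombination A (fun t => (z t : A)) c = A.d x) (t : T) :
    hA.augmentation (c t) = 0 := by
  obtain ⟨c, rfl⟩ := A.exists_mapCoeff_val_eq hc
  have h1 : Finsupp.linearCombination A (fun t => (z t : A)) (mapCoeff T A.cocycles.val c) =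
      A.cocycles.val (Finsupp.linearCombination A.cocycles z c) :=
    (map_linearCombination A.cocycles.val z c).symm
  have h2 := A.toCohomology_eq_zero_iff.2 ⟨x, hx.symm.trans h1⟩
  rw [map_linearCombination, funext hz] at h2
  exact hv.minimal _ h2 t

/-- Generation of `I` at cochain level: the coefficients can be taken to be cocycles, at the cost of
a coboundary. -/
theorem exists_linearCombination_add_d
    (hv : IsMinimalGenerators A.cohomologyGr hA.cohomologyAugmentation deg v)
    (hz : ∀ t, A.toCohomology (z t) = v t) {a : A} (ha : A.d a = 0) (ha' : hA.augmentation a = 0) :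
    ∃ (c : T →₀ A) (x : A), A.mapD T c = 0 ∧
      a = Finsupp.linearCombination A (fun t => (z t : A)) c + A.d x := by
  have h := hv.mem_span (A.toCohomology ⟨a, ha⟩) ha'
  rw [← Finsupp.range_linearCombination] at h
  obtain ⟨c, hc⟩ := h
  obtain ⟨c, rfl⟩ := A.mapCoeff_toCohomology_surjective c
  rw [← funext hz, ← map_linearCombination, eq_comm, ← sub_eq_zero, ← map_sub,
    toCohomology_eq_zero_iff] at hc
  obtain ⟨x, hx⟩ := hc
  refine ⟨mapCoeff T A.cocycles.val c, x, A.mapD_mapCoeff_val c, ?_⟩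
  have h1 : Finsupp.linearCombination A (fun t => (z t : A)) (mapCoeff T A.cocycles.val c) =
      A.cocycles.val (Finsupp.linearCombination A.cocycles z c) :=
    (map_linearCombination A.cocycles.val z c).symm
  rw [h1, hx]
  exact (add_sub_cancel _ _).symm

theorem mapS_linearCombination (A : DGAlgebra k) {X Y : Type*} (b : Y → X →₀ A) (c : Y →₀ A) :
    A.mapS X (Finsupp.linearCombination A b c) =
      Finsupp.linearCombination A (fun y => A.mapS X (b y)) (A.mapS Y c) := by
  induction c using Finsupp.induction_linear with
  | zero => simp
  | add f g hf hg => simp only [map_add, hf, hg]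
  | single y a => simp [mapS_smul]

end DGAlgebra

namespace DGModule

variable {k : Type u} [Field k] {A : DGAlgebra k}

theorem IsDGFreeQuotient.exists_basis {F : DGModule A} {N : Submodule A F}
    (h : F.IsDGFreeQuotient ⊥ N) : ∃ (I : Type u) (deg : I → ℤ) (e : I → F),
      (∀ i, e i ∈ F.gr (deg i)) ∧ (∀ i, F.d (e i) = 0) ∧ LinearIndependent A e ∧
      Submodule.span A (Set.range e) = N := by
  obtain ⟨I, e, he, hli, hspan⟩ := h
  choose deg hdeg using fun i => (he i).2.1
  refine ⟨I, deg, e, hdeg, fun i => (Submodule.mem_bot A).1 (he i).2.2,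
    LinearIndependent.of_comp _ hli, ?_⟩
  apply Submodule.map_injective_of_injective (f := (⊥ : Submodule A F).mkQ)
  · rw [← LinearMap.ker_eq_bot, Submodule.ker_mkQ]
  · rw [Submodule.map_span, ← Set.range_comp]
    exact hspan

theorem SemiFreeFiltration.exists_basis {F : DGModule A} (Φ : F.SemiFreeFiltration)
    (h : Φ.fil 1 = ⊤) : ∃ (I J : Type u) (degI : I → ℤ) (degJ : J → ℤ) (e : I → F) (f : J → F),
      (∀ i, e i ∈ F.gr (degI i)) ∧ (∀ j, f j ∈ F.gr (degJ j)) ∧ (∀ i, F.d (e i) = 0) ∧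
      (∀ j, F.d (f j) ∈ Submodule.span A (Set.range e)) ∧
      LinearIndependent A (Sum.elim e f) ∧
      Submodule.span A (Set.range (Sum.elim e f)) = ⊤ := by
  obtain ⟨I, degI, e, he, hde, hli, hspan⟩ := Φ.zero_free.exists_basis
  obtain ⟨J, f, hf, hlif, hspanf⟩ := Φ.succ_free 0
  choose degJ hdegJ using fun j => (hf j).2.1
  refine ⟨I, J, degI, degJ, e, f, he, hdegJ, hde, fun j => hspan ▸ (hf j).2.2, ?_, ?_⟩
  · have hmem : ∀ i, e i ∈ Φ.fil 0 := fun i => hspan ▸ Submodule.subset_span ⟨i, rfl⟩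
    have h1 : LinearIndependent A fun i => (⟨e i, hmem i⟩ : Φ.fil 0) :=
      LinearIndependent.of_comp (Φ.fil 0).subtype hli
    exact LinearIndependent.sumElim_of_quotient h1 f hlif
  · rw [Set.Sum.elim_range, Submodule.span_union, hspan, eq_top_iff]
    intro x _
    have hx : (Φ.fil 0).mkQ x ∈ (Φ.fil 1).map (Φ.fil 0).mkQ := ⟨x, h ▸ trivial, rfl⟩
    rw [← hspanf] at hx
    have e1 : Set.range (fun j => (Φ.fil 0).mkQ (f j)) = (Φ.fil 0).mkQ '' Set.range f :=
      Set.range_comp _ _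
    rw [e1, ← Submodule.map_span] at hx
    obtain ⟨y, hy, hxy⟩ := hx
    have h2 : x - y ∈ Φ.fil 0 := (Submodule.Quotient.eq _).1 hxy.symm
    exact Submodule.mem_sup.2 ⟨x - y, h2, y, hy, sub_add_cancel x y⟩

theorem mem_freeGrading_of_linearIndependent (F : DGModule A) {X : Type u} {deg : X → ℤ}
    {b : X → F} (hb : ∀ x, b x ∈ F.gr (deg x)) (hli : LinearIndependent A b) {c : X →₀ A} {i : ℤ}
    (hc : Finsupp.linearCombination A b c ∈ F.gr i) : c ∈ freeGrading A.gr deg i := by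
  have h := map_gradedProj (freeGrading A.gr deg) F.gr
    ((Finsupp.linearCombination A b).restrictScalars k)
    (fun i c hc => F.linearCombination_mem_gr hb hc) i c
  rw [LinearMap.restrictScalars_apply, LinearMap.restrictScalars_apply, gradedProj_of_mem _ hc] at h
  rw [← show gradedProj (freeGrading A.gr deg) i c = c from hli h]
  exact gradedProj_mem _ i c

/-- A quasi-isomorphism to the trivial module as a functional. -/
theorem exists_counit {hA : A.IsConnected} {F : DGModule A} (ε : Hom F hA.trivialModule)
    (hε : ε.IsQuasiIso) : ∃ η : F →ₗ[k] k, (∀ a m, η (a • m) = hA.augmentation a * η m) ∧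
      (∀ i, i ≠ 0 → ∀ m ∈ F.gr i, η m = 0) ∧ (∀ m, η (F.d m) = 0) ∧
      (∀ m, F.d m = 0 → η m = 0 → ∃ y, F.d y = m) ∧ ∃ w ∈ F.gr 0, F.d w = 0 ∧ η w = 1 := by
  obtain ⟨hinj, hsurj⟩ := ε.isQuasiIso_iff.1 hε
  let η : F →ₗ[k] k :=
    { toFun := fun m => (ε.toLinearMap m : hA.trivialModule)
      map_add' := fun a b => ε.toLinearMap.map_add a b
      map_smul' := fun c m => (ε.toLinearMap.restrictScalars k).map_smul c m }
  have hne : ∀ i, i ≠ 0 → ∀ m ∈ F.gr i, η m = 0 := fun i hi m hm => by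
    have h : η m ∈ DGAlgebra.trivialGr k i := ε.map_mem i m hm
    simpa [DGAlgebra.trivialGr, hi] using h
  refine ⟨η, fun a m => ε.toLinearMap.map_smul a m, hne, fun m => (ε.comm m).symm,
    fun m hm h0 => hinj m hm ⟨0, (map_zero _).trans h0.symm⟩, ?_⟩
  obtain ⟨w, hw, x, hx⟩ := hsurj (1 : k) rfl
  have hw1 : η w = 1 := (sub_eq_zero.1 hx.symm : _)
  refine ⟨gradedProj F.gr 0 w, gradedProj_mem _ _ _, ?_, ?_⟩
  · rw [← gradedProj_d, hw, map_zero]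
  · have h : η (gradedProj F.gr 0 w) = gradedProj (DGAlgebra.trivialGr k) 0 (η w) :=
      map_gradedProj F.gr (DGAlgebra.trivialGr k) η (fun i m hm => ε.map_mem i m hm) 0 w
    rw [h, hw1, gradedProj_of_mem]
    simp [DGAlgebra.trivialGr]

variable {hA : A.IsConnected} {T : Type u} {deg : T → ℤ} {v : T → A.Cohomology}

/-- Here `F` is free on cocycles `e i`, and there is at least one because `H(F) ≠ 0`. The cocycle `z
t • e i` is killed by `η`, so it is the differential of some `∑ c_j e_j`. Comparing coefficients at
`e i` gives `z t = d (c i)`, so `v t = 0`, against minimality. -/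
theorem isEmpty_of_fil_zero_eq_top
    (hv : IsMinimalGenerators A.cohomologyGr hA.cohomologyAugmentation deg v)
    {F : DGModule A} (ε : Hom F hA.trivialModule) (hε : ε.IsQuasiIso) (Φ : F.SemiFreeFiltration)
    (hΦ : Φ.fil 0 = ⊤) : IsEmpty T := by
  obtain ⟨z, -, hz⟩ := A.exists_homogeneous_cocycles hv.mem
  refine ⟨fun t => hv.ne_zero t ?_⟩
  rw [← hz t, DGAlgebra.toCohomology_eq_zero_iff]
  obtain ⟨I, degI, e, -, hde, hli, hspan⟩ := Φ.zero_free.exists_basis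
  obtain ⟨η, hη, -, -, hker, w, -, -, hw⟩ := exists_counit ε hε
  have hπ : hA.augmentation (z t : A) = 0 := by
    have := hv.augmentation_eq_zero hA.isConnectedGraded t
    rw [← hz t] at this
    exact this
  have hI : ∃ i, η (e i) ≠ 0 := by
    by_contra! h0
    have h1 : ∀ m ∈ Submodule.span A (Set.range e), η m = 0 := by
      intro m hm
      induction hm using Submodule.span_induction with
      | mem x hx => obtain ⟨i, rfl⟩ := hx; exact h0 i
      | zero => exact map_zero _
      | add x y _ _ hx hy => rw [map_add, hx, hy, add_zero]
      | smul a x _ hx => rw [hη, hx, mul_zero]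
    rw [h1 w (by rw [hspan, hΦ]; trivial)] at hw
    exact zero_ne_one hw
  obtain ⟨i, -⟩ := hI
  obtain ⟨y, hy⟩ := hker ((z t : A) • e i)
    (by rw [F.leibniz_sgn, hde, show A.d (z t : A) = 0 from (z t).2, zero_smul, smul_zero,
      add_zero]) (by rw [hη, hπ, zero_mul])
  have hy' : y ∈ Submodule.span A (Set.range e) := by rw [hspan, hΦ]; trivial
  rw [← Finsupp.range_linearCombination] at hy'
  obtain ⟨c, rfl⟩ := hy'
  have e2 : (fun i => F.d (e i)) = fun _ => 0 := funext hde
  rw [d_linearCombination, e2, ← Finsupp.linearCombination_single A (z t : A) i] at hy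
  have e3 : Finsupp.linearCombination A (fun _ : I => (0 : F)) (A.mapS I c) = 0 := by
    simp [Finsupp.linearCombination_apply]
  rw [e3, add_zero] at hy
  have h4 := DFunLike.congr_fun (hli hy) i
  exact ⟨c i, by simpa using h4⟩

/-! ### Comparison with the start of the minimal resolution of `k` -/

section GeneratorModule

variable (z : T → A.cocycles) (hzdeg : ∀ t, (z t : A) ∈ A.gr (deg t))

/-- The semi-free DG module on a generator `1` and generators `g t` with `d (g t) = z t • 1`. -/
@[reducible]
noncomputable def generatorModule : DGModule A :=
  twoStep (fun _ : PUnit.{u + 1} => 0) (fun t => deg t - 1)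
    (fun t => Finsupp.single PUnit.unit (z t : A))
    (fun t => single_mem_freeGrading A.gr _ (by simpa using hzdeg t))
    (fun t => by rw [A.mapD_single, show A.d (z t : A) = 0 from (z t).2, Finsupp.single_zero])

theorem generatorModule_d (g : generatorModule z hzdeg) :
    (generatorModule z hzdeg).d g = (A.mapD PUnit g.1 + Finsupp.single PUnit.unit
      (Finsupp.linearCombination A (fun t => (z t : A)) (A.mapS T g.2)), A.mapD T g.2) := by
  have h := Finsupp.apply_linearCombination A (Finsupp.lsingle (R := A) PUnit.unit)
    (fun t => (z t : A)) (A.mapS T g.2)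
  rw [Finsupp.lsingle_apply] at h
  rw [h]
  rfl

/-- The augmentation of `generatorModule`. -/
noncomputable def generatorCounit (hA : A.IsConnected) : generatorModule z hzdeg →ₗ[k] k :=
  hA.augmentation.toLinearMap ∘ₗ Finsupp.lapply PUnit.unit ∘ₗ LinearMap.fst k _ _

theorem generatorCounit_apply (g : generatorModule z hzdeg) :
    generatorCounit z hzdeg hA g = hA.augmentation (g.1 PUnit.unit) := rfl

theorem generatorCounit_smul (a : A) (g : generatorModule z hzdeg) :
    generatorCounit z hzdeg hA (a • g) = hA.augmentation a * generatorCounit z hzdeg hA g :=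
  map_mul hA.augmentation a (g.1 PUnit.unit)

theorem generatorCounit_eq_zero {i : ℤ} (hi : i ≠ 0) {g : generatorModule z hzdeg}
    (hg : g ∈ (generatorModule z hzdeg).gr i) : generatorCounit z hzdeg hA g = 0 :=
  hA.augmentation_of_mem (i - 0) _ (hg.1 PUnit.unit) (by simpa using hi)

theorem generatorCounit_gradedProj (g : generatorModule z hzdeg) :
    generatorCounit z hzdeg hA (gradedProj (generatorModule z hzdeg).gr 0 g) =
      generatorCounit z hzdeg hA g := by
  induction g using DirectSum.Decomposition.inductionOn (generatorModule z hzdeg).gr with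
  | zero => simp
  | add a b ha hb => simp only [map_add, ha, hb]
  | @homogeneous j m =>
    rcases eq_or_ne j 0 with rfl | h
    · rw [gradedProj_of_mem _ m.2]
    · rw [gradedProj_of_mem_ne _ m.2 h, generatorCounit_eq_zero z hzdeg h m.2, map_zero]

/-- The target `G` need not resolve `k`, but in it every `a • 1` with `a` a cocycle of augmentation
zero is a coboundary, because the `v t` generate `I`. This suffices to lift through two filtration
steps: `e i` goes to `η (e i) • 1`, and then `d (f j)` goes to such an `a • 1`, which can be
bounded. -/
theorem exists_generatorModule_lift
    (hv : IsMinimalGenerators A.cohomologyGr hA.cohomologyAugmentation deg v)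
    (hz : ∀ t, A.toCohomology (z t) = v t) {F : DGModule A} (Φ : F.SemiFreeFiltration)
    (hΦ : Φ.fil 1 = ⊤) (η : F →ₗ[k] k) (hη : ∀ a m, η (a • m) = hA.augmentation a * η m)
    (hη0 : ∀ i, i ≠ 0 → ∀ m ∈ F.gr i, η m = 0) (hηd : ∀ m, η (F.d m) = 0) :
    ∃ θ : F →ₗ[A] generatorModule z hzdeg,
      (∀ m, (generatorModule z hzdeg).d (θ m) = θ (F.d m)) ∧
      (∀ i, ∀ m ∈ F.gr i, θ m ∈ (generatorModule z hzdeg).gr i) ∧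
      ∀ m, generatorCounit z hzdeg hA (θ m) = η m := by
  classical
  obtain ⟨I, J, degI, degJ, e, f, he, hf, hde, hdf, hli, hspan⟩ := Φ.exists_basis hΦ
  set G := generatorModule z hzdeg with hG
  let ι : A →ₗ[A] G := LinearMap.inl A _ _ ∘ₗ Finsupp.lsingle PUnit.unit
  have hιa : ∀ a, ι a = (Finsupp.single PUnit.unit a, 0) := fun _ => rfl
  have hιd : ∀ a, G.d (ι a) = ι (A.d a) := fun a => by
    rw [generatorModule_d, hιa, hιa]
    simp
  have hιp : ∀ a, generatorCounit z hzdeg hA (ι a) = hA.augmentation a := fun a => by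
    rw [generatorCounit_apply, hιa]
    simp
  have hιgr : ∀ i, ∀ a ∈ A.gr i, ι a ∈ G.gr i := fun i a ha =>
    ⟨single_mem_freeGrading A.gr _ (by simpa using ha), zero_mem _⟩
  have hlie : LinearIndependent A e := hli.comp Sum.inl Sum.inl_injective
  let s (i : I) : A := algebraMap k A (η (e i))
  have key : ∀ j, ∃ u ∈ G.gr (degJ j), generatorCounit z hzdeg hA u = η (f j) ∧
      ∃ c, Finsupp.linearCombination A e c = F.d (f j) ∧
        G.d u = Finsupp.linearCombination A (ι ∘ s) c := by
    intro j
    have hj := hdf j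
    rw [← Finsupp.range_linearCombination] at hj
    obtain ⟨c, hc⟩ := hj
    have hcgr : c ∈ freeGrading A.gr degI (degJ j + 1) :=
      F.mem_freeGrading_of_linearIndependent he hlie (hc ▸ F.d_mem _ _ (hf j))
    -- Apply `d ∘ d = 0` to `f j` and use that the cocycles `e i` are linearly independent.
    have hcd : A.mapD I c = 0 := by
      apply hlie
      have h1 := F.d_linearCombination e c
      have e2 : (fun i => F.d (e i)) = fun _ => 0 := funext hde
      have e3 : Finsupp.linearCombination A (fun _ : I => (0 : F)) (A.mapS I c) = 0 := by
        simp [Finsupp.linearCombination_apply]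
      rw [hc, F.d_d, e2, e3, add_zero] at h1
      rw [← h1, map_zero]
    set a := Finsupp.linearCombination A s c with ha
    have had : A.d a = 0 := by
      rw [ha, Finsupp.linearCombination_apply, Finsupp.sum, map_sum]
      refine Finset.sum_eq_zero fun i _ => ?_
      rw [smul_eq_mul, A.d_mul_of_cocycle_right _ _ (A.d_algebraMap _),
        show A.d (c i) = 0 from DFunLike.congr_fun hcd i, zero_mul]
    have haπ : hA.augmentation a = 0 := by
      rw [← hηd (f j), ← hc, ha, Finsupp.linearCombination_apply, Finsupp.linearCombination_apply,
        Finsupp.sum, Finsupp.sum, map_sum, map_sum]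
      refine Finset.sum_congr rfl fun i _ => ?_
      rw [smul_eq_mul, map_mul, hη, AlgHom.commutes]
      rfl
    have hagr : a ∈ A.gr (degJ j + 1) := by
      rw [ha, Finsupp.linearCombination_apply]
      refine sum_mem fun i _ => ?_
      change c i * algebraMap k A (η (e i)) ∈ _
      by_cases hi : degI i = 0
      · have h1 : c i ∈ A.gr (degJ j + 1) := by simpa [hi] using hcgr i
        rw [← Algebra.commutes, ← Algebra.smul_def]
        exact Submodule.smul_mem _ _ h1
      · rw [hη0 _ hi _ (he i), map_zero, mul_zero]
        exact zero_mem _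
    obtain ⟨c', x, hc', hax⟩ := DGAlgebra.exists_linearCombination_add_d hv hz had haπ
    -- The twist by `mapS` cancels the one in the differential of `G`.
    let u₀ : G := (Finsupp.single PUnit.unit x, A.mapS T c')
    have hu₀ : G.d u₀ = ι a := by
      rw [generatorModule_d, hιa, A.mapS_mapS, A.mapD_mapS, hc', A.mapD_single, ← Finsupp.single_add,
        add_comm, ← hax, map_zero, neg_zero]
    -- A scalar multiple of the cocycle `1` corrects the augmentation without changing the
    -- differential.
    let u₁ : G := u₀ + ι (algebraMap k A (η (f j) - generatorCounit z hzdeg hA u₀))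
    have hu₁ : G.d u₁ = ι a := by
      rw [map_add, hu₀, hιd, A.d_algebraMap, map_zero, add_zero]
    have hpu₁ : generatorCounit z hzdeg hA u₁ = η (f j) := by
      rw [map_add, hιp, AlgHom.commutes]
      exact add_sub_cancel _ _
    refine ⟨gradedProj G.gr (degJ j) u₁, gradedProj_mem _ _ _, ?_, c, hc, ?_⟩
    · by_cases hj0 : degJ j = 0
      · rw [hj0, generatorCounit_gradedProj, hpu₁]
      · rw [generatorCounit_eq_zero z hzdeg hj0 (gradedProj_mem _ _ _), hη0 _ hj0 _ (hf j)]
    · rw [← gradedProj_d, hu₁, gradedProj_of_mem _ (hιgr _ _ hagr), ha,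
        Finsupp.apply_linearCombination]
  choose u hugr hup c hc hdu using key
  let b := Module.Basis.mk hli hspan.ge
  let θ : F →ₗ[A] G := b.constr ℕ (Sum.elim (ι ∘ s) u)
  have hθe : ∀ i, θ (e i) = ι (s i) := fun i => by
    have h := b.constr_basis ℕ (Sum.elim (ι ∘ s) u) (Sum.inl i)
    rwa [Module.Basis.mk_apply] at h
  have hθf : ∀ j, θ (f j) = u j := fun j => by
    have h := b.constr_basis ℕ (Sum.elim (ι ∘ s) u) (Sum.inr j)
    rwa [Module.Basis.mk_apply] at h
  have hind : ∀ P : F → Prop, (∀ i, P (e i)) → (∀ j, P (f j)) → P 0 →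
      (∀ x y, P x → P y → P (x + y)) → (∀ (a : A) x, P x → P (a • x)) → ∀ m, P m := by
    intro P h1 h2 h3 h4 h5 m
    have hm : m ∈ Submodule.span A (Set.range (Sum.elim e f)) := hspan ▸ trivial
    induction hm using Submodule.span_induction with
    | mem x hx => obtain ⟨i | j, rfl⟩ := hx; exacts [h1 i, h2 j]
    | zero => exact h3
    | add x y _ _ hx hy => exact h4 x y hx hy
    | smul a x _ hx => exact h5 a x hx
  refine ⟨θ, hind _ ?_ ?_ ?_ ?_ ?_, ?_, hind _ ?_ ?_ ?_ ?_ ?_⟩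
  · intro i
    rw [hθe, hιd, A.d_algebraMap, hde, map_zero, map_zero]
  · intro j
    rw [hθf, hdu, ← hc, Finsupp.apply_linearCombination]
    congr 2
    exact funext fun i => (hθe i).symm
  · simp
  · intro x y hx hy
    simp only [map_add, hx, hy]
  · intro a x hx
    rw [map_smul, DGModule.leibniz_sgn, F.leibniz_sgn, map_add, map_smul, map_smul, hx]
  · intro i m hm
    have hdeg : ∀ x, Sum.elim e f x ∈ F.gr (Sum.elim degI degJ x) := by
      rintro (i | j)
      exacts [he i, hf j]
    have hm' : m ∈ Submodule.span A (Set.range (Sum.elim e f)) := hspan ▸ trivial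
    rw [← Finsupp.range_linearCombination] at hm'
    obtain ⟨c, rfl⟩ := hm'
    rw [Finsupp.linearCombination_apply, map_finsuppSum]
    refine sum_mem fun x _ => ?_
    change θ (c x • Sum.elim e f x) ∈ _
    rw [map_smul]
    have hcx := F.mem_freeGrading_of_linearIndependent hdeg hli hm x
    rcases x with i' | j
    · change c (Sum.inl i') • θ (e i') ∈ G.gr i
      rw [hθe]
      by_cases hi : degI i' = 0
      · have := G.smul_mem _ _ _ _ hcx
          (hιgr 0 _ (DGAlgebra.IsConnected.algebraMap_mem A (η (e i'))))
        simpa [hi] using this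
      · rw [show s i' = 0 by simp only [s, hη0 _ hi _ (he i'), map_zero], map_zero, smul_zero]
        exact zero_mem _
    · change c (Sum.inr j) • θ (f j) ∈ G.gr i
      rw [hθf]
      have := G.smul_mem _ _ _ _ hcx (hugr j)
      simpa using this
  · intro i
    rw [hθe, hιp, AlgHom.commutes]
    rfl
  · intro j
    rw [hθf, hup]
  · simp
  · intro x y hx hy
    simp only [map_add, hx, hy]
  · intro a x hx
    rw [map_smul, generatorCounit_smul, hx, hη]

end GeneratorModule

/-- Cochain analogue of `linearIndependent_of_projDim_le_one`. The map `θ` to the generator module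
sends a degree 0 cocycle `w` with `η w = 1` to the generator `1`. Choose `u t` with `d (u t) = z t •
w`. The `T`-coordinates of `θ (u t)` give a matrix `b` of cocycles with `∑ b_ts z_s` cohomologous to
`z_t`, so its class is the identity modulo `I`. A relation among the `v t` yields a cocycle of `F`
in the kernel of `η`, hence a coboundary; applying `θ` and reading the `T`-coordinates shows that
the relation times the class of `b` is zero. -/
theorem linearIndependent_of_fil_one_eq_top
    (hv : IsMinimalGenerators A.cohomologyGr hA.cohomologyAugmentation deg v)
    {F : DGModule A} (ε : Hom F hA.trivialModule) (hε : ε.IsQuasiIso) (Φ : F.SemiFreeFiltration)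
    (hΦ : Φ.fil 1 = ⊤) : LinearIndependent A.Cohomology v := by
  classical
  obtain ⟨z, hzdeg, hz⟩ := A.exists_homogeneous_cocycles hv.mem
  have hdz : ∀ t, A.d (z t : A) = 0 := fun t => (z t).2
  have hπz : ∀ t, hA.augmentation (z t : A) = 0 := fun t =>
    hA.augmentation_of_mem _ _ (hzdeg t) (hv.deg_pos t).ne'
  obtain ⟨η, hη, hη0, hηd, hker, w, hw0, hdw, hw1⟩ := exists_counit ε hε
  obtain ⟨θ, hθd, hθgr, hθ⟩ := exists_generatorModule_lift z hzdeg hv hz Φ hΦ η hη hη0 hηd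
  have hu : ∀ t, ∃ u, F.d u = (z t : A) • w ∧ η u = 0 := fun t => by
    obtain ⟨u, hu⟩ := hker ((z t : A) • w)
      (by rw [F.leibniz_sgn, hdw, hdz, zero_smul, smul_zero, add_zero])
      (by rw [hη, hπz, zero_mul])
    -- Subtracting a multiple of the cocycle `w` arranges `η (u t) = 0`, so that the cocycle `r`
    -- below lies in the kernel of `η`.
    refine ⟨u - η u • w, ?_, ?_⟩
    · rw [map_sub, map_smul, hdw, smul_zero, sub_zero, hu]
    · rw [map_sub, map_smul, hw1, smul_eq_mul, mul_one, sub_self]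
  choose u hdu hηu using hu
  have hθw : θ w = (Finsupp.single PUnit.unit 1, 0) := by
    have hgr := hθgr 0 w hw0
    have hd := hθd w
    rw [hdw, map_zero, generatorModule_d, Prod.mk_eq_zero] at hd
    obtain ⟨hd1, hd2⟩ := hd
    have h1 : hA.augmentation ((θ w).1 PUnit.unit) = 1 := (hθ w).trans hw1
    refine Prod.ext (Finsupp.ext fun _ => ?_) (Finsupp.ext fun t => ?_)
    · rw [Finsupp.single_eq_same, ← map_one (algebraMap k A), ← h1]
      exact (hA.algebraMap_augmentation (by simpa using hgr.1 PUnit.unit)).symm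
    · have h2 : (θ w).2 t ∈ A.gr (0 - (deg t - 1)) := hgr.2 t
      have hpos := hv.deg_pos t
      rcases eq_or_ne (deg t) 1 with ht | ht
      · rw [ht, sub_self, sub_zero] at h2
        have h3 := DGAlgebra.augmentation_eq_zero_of_linearCombination hv hz
          (c := A.mapS T (θ w).2) (x := -(θ w).1 PUnit.unit)
          (by rw [A.mapD_mapS, hd2, map_zero, neg_zero]) (by
            rw [map_neg, eq_neg_iff_add_eq_zero, add_comm]
            simpa using DFunLike.congr_fun hd1 PUnit.unit) t
        rw [A.mapS_apply, hA.augmentation_sgn] at h3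
        rw [← hA.algebraMap_augmentation h2, h3, map_zero]
        rfl
      · rw [hA.gr_neg _ (by omega)] at h2
        exact (Submodule.mem_bot k).1 h2
  let b (t : T) : T →₀ A := A.mapS T (θ (u t)).2
  have hθu : ∀ t, A.mapD T (b t) = 0 ∧ Finsupp.linearCombination A (fun t => (z t : A)) (b t) =
      z t - A.d ((θ (u t)).1 PUnit.unit) := fun t => by
    have hd := hθd (u t)
    rw [hdu, map_smul, hθw, generatorModule_d] at hd
    obtain ⟨hd1, hd2⟩ := Prod.mk.inj hd
    refine ⟨?_, ?_⟩
    · rw [A.mapD_mapS, hd2, smul_zero, map_zero, neg_zero]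
    · rw [eq_sub_iff_add_eq']
      simpa using DFunLike.congr_fun hd1 PUnit.unit
  choose b' hb' using fun t => A.exists_mapCoeff_val_eq (hθu t).1
  rw [linearIndependent_iff]
  intro h hh
  obtain ⟨c, rfl⟩ := A.mapCoeff_toCohomology_surjective h
  refine hA.isConnectedGraded.eq_zero_of_sum_smul_eq_zero
    (fun t => mapCoeff T A.toCohomology (b' t)) (fun t s => ?_) _ ?_
  · have h1 := DGAlgebra.augmentation_eq_zero_of_linearCombination hv hz
      (c := b t - Finsupp.single t 1) (x := -(θ (u t)).1 PUnit.unit)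
      (by rw [map_sub, (hθu t).1, A.mapD_single, A.d_one, Finsupp.single_zero, sub_zero])
      (by rw [map_sub, (hθu t).2, Finsupp.linearCombination_single, one_smul, map_neg A.d]; abel) s
    rw [Finsupp.sub_apply, map_sub, ← hb'] at h1
    rw [map_sub]
    have h2 : hA.cohomologyAugmentation (Finsupp.single t (1 : A.Cohomology) s) =
        hA.augmentation (Finsupp.single t (1 : A) s) := by
      by_cases hts : t = s
      · subst hts; simp
      · simp [Finsupp.single_eq_of_ne (Ne.symm hts)]
    rw [h2]
    exact h1
  · have h1 : Finsupp.linearCombination A (fun t => (z t : A)) (mapCoeff T A.cocycles.val c) =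
        A.cocycles.val (Finsupp.linearCombination A.cocycles z c) :=
      (map_linearCombination A.cocycles.val z c).symm
    rw [← funext hz, ← map_linearCombination, DGAlgebra.toCohomology_eq_zero_iff] at hh
    obtain ⟨y₀, hy₀⟩ := hh
    -- Normalised to have augmentation zero, so that `η (y • w) = 0`.
    let y := y₀ - algebraMap k A (hA.augmentation y₀)
    have hy : A.d y = Finsupp.linearCombination A (fun t => (z t : A))
        (mapCoeff T A.cocycles.val c) := by
      rw [h1, map_sub, A.d_algebraMap, sub_zero, hy₀]
      rfl
    have hyπ : hA.augmentation y = 0 := by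
      rw [map_sub, AlgHom.commutes]
      exact sub_self _
    set c' := mapCoeff T A.cocycles.val c with hc'
    have hdc' : A.mapD T c' = 0 := A.mapD_mapCoeff_val c
    let r : F := Finsupp.linearCombination A u (A.mapS T c') - y • w
    have hdr : F.d r = 0 := by
      have e1 : (fun t => F.d (u t)) = LinearMap.toSpanSingleton A F w ∘ fun t => (z t : A) :=
        funext hdu
      rw [map_sub, d_linearCombination, A.mapD_mapS, hdc', map_zero, neg_zero, map_zero, zero_add,
        A.mapS_mapS, e1, ← Finsupp.apply_linearCombination, ← hy, F.leibniz_sgn, hdw, smul_zero,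
        add_zero]
      exact sub_self _
    have hηr : η r = 0 := by
      rw [map_sub, hη, hyπ, zero_mul, sub_zero, Finsupp.linearCombination_apply, Finsupp.sum,
        map_sum]
      exact Finset.sum_eq_zero fun t _ => by rw [hη, hηu, mul_zero]
    obtain ⟨q, hq⟩ := hker r hdr hηr
    -- The term `y • θ w` disappears here, as `θ w` has no `T`-coordinates.
    have h2 : A.mapD T (θ q).2 =
        Finsupp.linearCombination A (fun t => (θ (u t)).2) (A.mapS T c') := by
      have h3 := congrArg Prod.snd (hθd q)
      rw [generatorModule_d, hq, map_sub, map_smul, hθw, Finsupp.apply_linearCombination] at h3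
      have h4 := Finsupp.apply_linearCombination A
        (LinearMap.snd A (PUnit.{u + 1} →₀ A) (T →₀ A)) (θ ∘ u) (A.mapS T c')
      rw [Prod.snd_sub, Prod.smul_snd, smul_zero, sub_zero] at h3
      exact h3.trans h4
    have h5 : A.mapD T (-A.mapS T (θ q).2) = Finsupp.linearCombination A b c' := by
      rw [map_neg, A.mapD_mapS, neg_neg, h2, DGAlgebra.mapS_linearCombination, A.mapS_mapS]
    rw [← mapCoeff_linearCombination, DGAlgebra.mapCoeff_toCohomology_eq_zero_iff]
    refine ⟨_, h5.trans ?_⟩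
    rw [mapCoeff_linearCombination, funext hb']

end DGModule

/-! ### Comparison of the dimensions -/

/-- Both infima are attained when finite. The filtration found may be shorter than `n`, but
monotonicity still gives `F(n) = F`. -/
theorem DGModule.exists_filtration_of_coneLength_le {k : Type u} [Field k] {A : DGAlgebra k}
    {M : DGModule A} {n : ℕ} (h : M.coneLength ≤ n) :
    ∃ (F : DGModule A) (ε : Hom F M) (Φ : F.SemiFreeFiltration), ε.IsQuasiIso ∧ Φ.fil n = ⊤ := by
  by_contra! hc
  have h1 : ((n + 1 : ℕ) : ℕ∞) ≤ M.coneLength := by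
    refine le_iInf₂ fun F hF => le_iInf₂ fun m hm => ?_
    obtain ⟨-, ε, hε⟩ := hF
    obtain ⟨Φ, -, hΦ, -⟩ := hm
    by_contra! hlt
    have hmn : m ≤ n := by have := Nat.cast_lt.1 hlt; omega
    exact hc F ε Φ hε (eq_top_iff.2 (hΦ ▸ Φ.mono hmn))
  have h2 := h1.trans h
  rw [Nat.cast_le] at h2
  omega

theorem eq_one_iff_of_dichotomy {x : ℕ∞} {P E : Prop} (h1 : x ≤ 1 ↔ P) (h0 : x ≤ 0 ↔ E) :
    x = 1 ↔ P ∧ ¬E := by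
  rw [← h1, ← h0, nonpos_iff_eq_zero, ← ne_eq, ← Order.one_le_iff_ne_zero]
  exact ⟨fun h => ⟨h.le, h.ge⟩, fun h => le_antisymm h.1 h.2⟩

theorem propositionA {k : Type u} [Field k] (A : DGAlgebra k) (hA : A.IsConnected) :
    (hA.trivialModule.coneLength = 1 ↔ A.leftGlobalDim = 1) ∧
      (A.leftGlobalDim = 1 ↔ gradedGlobalDim A.cohomologyGr = 1) := by
  have hR := hA.isConnectedGraded
  obtain ⟨T, deg, v, hv⟩ := hR.exists_isMinimalGenerators
  have cone_one : hA.trivialModule.coneLength ≤ 1 → LinearIndependent A.Cohomology v := fun h => by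
    obtain ⟨F, ε, Φ, hε, hΦ⟩ := DGModule.exists_filtration_of_coneLength_le (n := 1) h
    exact DGModule.linearIndependent_of_fil_one_eq_top hv ε hε Φ hΦ
  have cone_zero : hA.trivialModule.coneLength ≤ 0 → IsEmpty T := fun h => by
    obtain ⟨F, ε, Φ, hε, hΦ⟩ := DGModule.exists_filtration_of_coneLength_le (n := 0) h
    exact DGModule.isEmpty_of_fil_zero_eq_top hv ε hε Φ hΦ
  have le_global : hA.trivialModule.coneLength ≤ A.leftGlobalDim := le_iSup DGModule.coneLength _
  have le_gr : (GrModule.trivial hR).projDim ≤ gradedGlobalDim A.cohomologyGr :=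
    le_iSup GrModule.projDim _
  -- In each of the three dichotomies the bound on the invariant is used only for `k`, while the
  -- converse is proved for every module concerned.
  have e1 := eq_one_iff_of_dichotomy (x := hA.trivialModule.coneLength)
    ⟨cone_one, fun h => DGModule.coneLength_le_one hv h _⟩
    ⟨cone_zero, fun h => (DGModule.coneLength_eq_zero hv _).le⟩
  have e2 := eq_one_iff_of_dichotomy (x := A.leftGlobalDim)
    ⟨fun h => cone_one (le_global.trans h),
      fun h => iSup_le fun M => DGModule.coneLength_le_one hv h M⟩
    ⟨fun h => cone_zero (le_global.trans h),
      fun h => iSup_le fun M => (DGModule.coneLength_eq_zero hv M).le⟩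
  have e3 := eq_one_iff_of_dichotomy (x := gradedGlobalDim A.cohomologyGr) (E := IsEmpty T)
    ⟨fun h => hv.linearIndependent_of_projDim_le_one hR (le_gr.trans h),
      fun h => iSup_le fun N => hv.projDim_le_one hR h N⟩
    ⟨fun h => by
      obtain ⟨m, hm, hd⟩ := (GrModule.projDim_le_iff (n := 0)).1 (le_gr.trans h)
      obtain rfl : m = 0 := by omega
      exact hv.isEmpty_of_isProjective hR hd,
      fun h => iSup_le fun N => (hv.projDim_eq_zero hR N).le⟩
  exact ⟨e1.trans e2.symm, e2.trans e3.symm⟩
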